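/- All graphs are finite and simple. For a graph $G$ let $\alpha(G)$ be the maximum size of an independent set of $G$ and $i(G)$ the minimum size of an inclusion-maximal independent set of $G$; $G$ is almost well-covered if $\alpha(G)-i(G)=1$. A graph is $\{C_3,C_4,C_5,C_7\}$-free if none of its induced subgraphs is isomorphic to a cycle of length $3$, $4$, $5$ or $7$. Theorem. Given a $\{C_3,C_4,C_5,C_7\}$-free graph $G$, it can be decided in polynomial time whether $G$ is almost well-covered. That is, there are a (deterministic, multi-stack) Turing machine $M$ and a polynomial $p$ such that for every $n\ge 0$ and every $\{C_3,C_4,C_5,C_7\}$-free graph $G$ with vertex set $\{0,\dots,n-1\}$, the machine $M$, started on the adjacency matrix of $G$ (written row by row, each row followed by an end marker, hence a word of length $n^2+n$), halts after at most $p(n^2+n)$ steps, with output $1$ if $G$ is almost well-covered and output $0$ otherwise. -/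

import Mathlib

open SimpleGraph

/-- The minimum size `i(G)` of an inclusion-maximal independent set of `G`. -/
noncomputable def minMaximalIndepNum {V : Type*} (G : SimpleGraph V) : ℕ :=
  sInf {k : ℕ | ∃ s : Finset V, Maximal (fun t : Finset V => G.IsIndepSet t) s ∧ s.card = k}

/-- On a finite vertex set `i(G)` is attained by a maximal independent set. -/
theorem exists_card_eq_minMaximalIndepNum {V : Type*} [Finite V] (G : SimpleGraph V) :
    ∃ s : Finset V, Maximal (fun t : Finset V => G.IsIndepSet t) s ∧
      s.card = minMaximalIndepNum G := by
  have h : {k : ℕ | ∃ s : Finset V,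
      Maximal (fun t : Finset V => G.IsIndepSet t) s ∧ s.card = k}.Nonempty := by
    obtain ⟨s, -, hs⟩ := Finite.exists_le_maximal (p := fun t : Finset V => G.IsIndepSet t)
      (a := ∅) (by simp [SimpleGraph.IsIndepSet])
    exact ⟨s.card, s, hs, rfl⟩
  exact Nat.sInf_mem h

theorem minMaximalIndepNum_le_indepNum {V : Type*} [Finite V] (G : SimpleGraph V) :
    minMaximalIndepNum G ≤ G.indepNum := by
  have := Fintype.ofFinite V
  obtain ⟨s, hs, h⟩ := exists_card_eq_minMaximalIndepNum G
  rw [← h]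
  exact SimpleGraph.IsIndepSet.card_le_indepNum hs.prop

/-- The independence gap `α(G) - i(G)` of a finite graph; the subtraction does not truncate, by
`minMaximalIndepNum_le_indepNum`. -/
noncomputable def independenceGap {V : Type*} (G : SimpleGraph V) : ℕ :=
  G.indepNum - minMaximalIndepNum G

/-- A graph is almost well-covered if its independence gap is one. -/
def AlmostWellCovered {V : Type*} (G : SimpleGraph V) : Prop :=
  independenceGap G = 1

/-- `G` is `{C₃, C₄, C₅, C₇}`-free: none of these cycles is isomorphic to an induced subgraph
of `G`. -/
def IsC3C4C5C7Free {V : Type*} (G : SimpleGraph V) : Prop :=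
  ∀ k ∈ ({3, 4, 5, 7} : Set ℕ), ¬ (cycleGraph k).IsIndContained G

/-- The finite simple graphs given as input to an algorithm: graphs on the vertices
`0, …, n - 1`, for any `n` (including the null graph). -/
abbrev InputGraph : Type := Σ n : ℕ, SimpleGraph (Fin n)

open Classical in
/-- The adjacency matrix of a graph, written row by row as a word over the three-letter alphabet
`{some true, some false, none}`; the letter `none` marks the end of each row. -/
noncomputable def encodeGraph (G : InputGraph) : List (Option Bool) :=
  (List.finRange G.1).flatMap fun i =>
    (List.finRange G.1).map (fun j => some (decide (G.2.Adj i j))) ++ [none]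

open Classical in
/-- The decision problem `P` on the class `C` of graphs is solvable in polynomial time: there are
a Turing machine and a polynomial `p` such that, for every graph `G` in `C`, the machine, started
on the adjacency matrix of `G`, halts after at most `p(ℓ)` steps, where `ℓ` is the length
of the input word, with output the single bit that tells whether `P G` holds. -/
def DecidableInPolyTimeOn (C P : InputGraph → Prop) : Prop :=
  Nonempty (Turing.TM2ComputableInPolyTime
    (fun G : {G : InputGraph // C G} => encodeGraph G.1) Computability.encodeBool
    (fun G => decide (P G.1)))

/-!
The theorem holds because, on `{C₃, C₄, C₅, C₇}`-free graphs, being almost well-covered is a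
first-order property, and first-order properties of graphs are decidable in polynomial time.

*First-order definability.* Call a vertex a core vertex if it has degree at least two and no
adjacent leaf. If an independent set `B` of vertices of degree at least two dominates the core and
everything in an independent set `A`, and no vertex of `A` is adjacent to a leaf, then `A` can
replace `B` in a suitable maximal independent set: a neighbor of `A` that `B` does not dominate has
a leaf, and this leaf can be put into the set in advance. So the independence gap is at least
`|A| - |B|` (`card_le_card_add_independenceGap`, `HasWitness.le_independenceGap`).

In a graph without short cycles, every core vertex `v` yields an exchange of gain one near `v`
(`exists_isLocalGadget`), obtained from the exchange of a single vertex for its core neighbors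
(`HasNoShortCycles.exists_star_gadget`). If the gap is at most one, two exchanges that are far from
each other cannot be independent, so that they use adjacent support vertices; among 68 pairwise
distant ones this would produce a cycle of length four (`card_le_of_pairwise_far`). Moreover, a
gap of at most one forces each core vertex to have at most two core neighbors, so that balls in the
core are small. Hence the core has at most `67 * 3 ^ 10` vertices (`card_core_le`).

When the core is bounded, a gap of at least `k` has a witness `A`, `B` of bounded size: dominate
each core vertex by one vertex of `B`, and add boundedly many vertices of `B` with at least two
leaves (`exists_hasWitness`). So the gap is one if and only if the core is bounded, there is a bounded
witness for `k = 1`, and there is none for `k = 2` (`almostWellCovered_iff`). This is a first-order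
sentence (`FODefinable.boundedCore_and_hasWitness`).

*Polynomial time.* For a sentence with `d` nested quantifiers, the machine keeps the adjacency
matrix on a work tape, made of two stacks, where each cell also carries the sets of variables whose
value is its row and those whose value is its column. A finite transducer that passes over the tape
can move the value of a variable from one vertex to the next, or look for a cell that makes an
atomic formula true. A quantifier becomes a loop over the vertices, and the truth values of
subformulas are kept on a stack (`runs_checkRoutine`, `decidableInPolyTimeOn_of_sentence`).
-/

/-! ### Structured programs for multi-stack machines -/

namespace Turing.TM2

variable {K : Type} {Γ : K → Type} {σ Λ Λ' Λ'' : Type}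

/-- Rename the labels that a statement jumps to. -/
def Stmt.mapLabel (f : Λ → Λ') : Stmt Γ Λ σ → Stmt Γ Λ' σ
  | .push k g q => .push k g (q.mapLabel f)
  | .peek k g q => .peek k g (q.mapLabel f)
  | .pop k g q => .pop k g (q.mapLabel f)
  | .load g q => .load g (q.mapLabel f)
  | .branch p q₁ q₂ => .branch p (q₁.mapLabel f) (q₂.mapLabel f)
  | .goto l => .goto fun v => f (l v)
  | .halt => .halt

theorem Stmt.mapLabel_mapLabel (f : Λ → Λ') (g : Λ' → Λ'') (c : Stmt Γ Λ σ) :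
    (c.mapLabel f).mapLabel g = c.mapLabel (g ∘ f) := by
  induction c <;> simp_all [Stmt.mapLabel]

theorem Stmt.mapLabel_id (c : Stmt Γ Λ σ) : c.mapLabel id = c := by
  induction c <;> simp_all [Stmt.mapLabel]

variable [DecidableEq K]

theorem stepAux_mapLabel (f : Λ → Λ') (c : Stmt Γ Λ σ) (v : σ) (S : ∀ k, List (Γ k)) :
    stepAux (c.mapLabel f) v S =
      ⟨(stepAux c v S).l.map f, (stepAux c v S).var, (stepAux c v S).stk⟩ := by
  induction c generalizing v S with
  | branch p q₁ q₂ h₁ h₂ => cases h : p v <;> simp [Stmt.mapLabel, h, h₁, h₂]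
  | _ => simp_all [Stmt.mapLabel]

/-- The machine `M` gets from the configuration `a` to the configuration `b` in at most `t`
steps. -/
def ReachesIn (M : Λ → Stmt Γ Λ σ) (t : ℕ) (a b : Cfg Γ Λ σ) : Prop :=
  ∃ s ≤ t, (flip bind (step M))^[s] (some a) = some b

theorem ReachesIn.trans {M : Λ → Stmt Γ Λ σ} {t u : ℕ} {a b c : Cfg Γ Λ σ}
    (h : ReachesIn M t a b) (h' : ReachesIn M u b c) : ReachesIn M (t + u) a c := by
  obtain ⟨s, hs, h⟩ := h
  obtain ⟨s', hs', h'⟩ := h'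
  exact ⟨s' + s, by omega, by rw [Function.iterate_add_apply, h, h']⟩

theorem ReachesIn.single {M : Λ → Stmt Γ Λ σ} {l : Λ} {v : σ} {S : ∀ k, List (Γ k)} :
    ReachesIn M 1 ⟨some l, v, S⟩ (stepAux (M l) v S) :=
  ⟨1, le_rfl, rfl⟩

/-- A program fragment with one entry and one exit: the statement at each of its labels may jump
to a label of the fragment or, as `none`, to the exit. -/
structure Routine (Γ : K → Type) (σ : Type) where
  /-- the labels of the fragment -/
  Label : Type
  /-- a fragment has finitely many labels -/
  [fintypeLabel : Fintype Label]
  /-- the label where the fragment is entered -/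
  entry : Label
  /-- the statement at each label -/
  code : Label → Stmt Γ (Option Label) σ

namespace Routine

/-- Run from the registers and stacks `s`, the routine `R` exits with the registers and stacks `s'`
after at most `t` steps. This is asserted of every machine that contains `R`, with labels renamed
by `e` and the exit at `x`, so that routines can be composed without reference to a machine. -/
def Runs (R : Routine Γ σ) (s s' : σ × ∀ k, List (Γ k)) (t : ℕ) : Prop :=
  ∀ (Λ : Type) (M : Λ → Stmt Γ Λ σ) (e : R.Label → Λ) (x : Λ),
    (∀ l, M (e l) = (R.code l).mapLabel fun o => o.elim x e) →
    ReachesIn M t ⟨some (e R.entry), s.1, s.2⟩ ⟨some x, s'.1, s'.2⟩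

variable {R R' : Routine Γ σ} {s s' s'' : σ × ∀ k, List (Γ k)} {t t' : ℕ}

theorem Runs.mono (h : R.Runs s s' t) (ht : t ≤ t') : R.Runs s s' t' := fun Λ M e x hM =>
  let ⟨u, hu, hr⟩ := h Λ M e x hM
  ⟨u, hu.trans ht, hr⟩

/-- A routine that executes one statement and exits. -/
def single (c : Stmt Γ Unit σ) : Routine Γ σ where
  Label := Unit
  entry := ()
  code _ := c.mapLabel fun _ => none

theorem runs_single {c : Stmt Γ Unit σ} (h : stepAux c s.1 s.2 = ⟨some (), s'.1, s'.2⟩) :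
    (single c).Runs s s' 1 := by
  intro Λ M e x hM
  refine ⟨1, le_rfl, congrArg some <| (congrArg (stepAux · s.1 s.2) (hM ())).trans ?_⟩
  simp only [single, Stmt.mapLabel_mapLabel, stepAux_mapLabel, h]
  rfl

/-- Sequential composition. -/
def seq (R R' : Routine Γ σ) : Routine Γ σ where
  Label := R.Label ⊕ R'.Label
  fintypeLabel := @instFintypeSum _ _ R.fintypeLabel R'.fintypeLabel
  entry := .inl R.entry
  code
    | .inl l => (R.code l).mapLabel fun o => some (o.elim (.inr R'.entry) .inl)
    | .inr l => (R'.code l).mapLabel (Option.map .inr)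

theorem Runs.seq (h : R.Runs s s' t) (h' : R'.Runs s' s'' t') :
    (R.seq R').Runs s s'' (t + t') := by
  intro Λ M e x hM
  refine (h Λ M (e ∘ .inl) (e (.inr R'.entry)) fun l => ?_).trans
    (h' Λ M (e ∘ .inr) x fun l => ?_)
  · refine (hM (.inl l)).trans ?_
    simp only [Routine.seq, Stmt.mapLabel_mapLabel]
    congr 1; funext o; cases o <;> rfl
  · refine (hM (.inr l)).trans ?_
    simp only [Routine.seq, Stmt.mapLabel_mapLabel]
    congr 1; funext o; cases o <;> rfl

/-- Repeat a routine as long as the registers satisfy the test `p`. -/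
def loop (p : σ → Bool) (R : Routine Γ σ) : Routine Γ σ where
  Label := Option R.Label
  fintypeLabel := @instFintypeOption _ R.fintypeLabel
  entry := none
  code
    | none => .branch p (.goto fun _ => some (some R.entry)) (.goto fun _ => none)
    | some l => (R.code l).mapLabel some

theorem runs_loop_of_false {p : σ → Bool} (h : p s.1 = false) : (loop p R).Runs s s 1 := by
  intro Λ M e x hM
  refine ⟨1, le_rfl, congrArg some <| (congrArg (stepAux · s.1 s.2) (hM none)).trans ?_⟩
  simp [loop, Stmt.mapLabel, h]
  rfl

theorem runs_loop_of_true {p : σ → Bool} (hp : p s.1 = true) (h : R.Runs s s' t)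
    (h' : (loop p R).Runs s' s'' t') : (loop p R).Runs s s'' (1 + t + t') := by
  intro Λ M e x hM
  refine ReachesIn.trans (ReachesIn.trans (b := ⟨some (e (some R.entry)), s.1, s.2⟩) ?_ <|
    h Λ M (e ∘ some) (e none) fun l => ?_) (h' Λ M e x hM)
  · refine ⟨1, le_rfl, congrArg some <| (congrArg (stepAux · s.1 s.2) (hM none)).trans ?_⟩
    simp [loop, Stmt.mapLabel, hp]
    rfl
  · refine (hM (some l)).trans ?_
    simp only [loop, Stmt.mapLabel_mapLabel]
    congr 1; funext o; cases o <;> rfl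

end Routine

end Turing.TM2

section ModelChecker

open Turing TM2

/-! ### The stacks of the model checker -/

/-- The stacks of the model checker: the input, the truth values computed so far (at the end, the
output), and the two halves of the work tape, to the right and to the left of the head. -/
inductive CheckerStack
  | inp | out | right | left
  deriving DecidableEq

instance : Fintype CheckerStack where
  elems := {.inp, .out, .right, .left}
  complete k := by cases k <;> simp

/-- The letters of the work tape for `d` variables: a cell of the adjacency matrix together
with two sets of variables, those whose value is the row and those whose value is the column of the
cell, or the end of a row. -/
abbrev Letter (d : ℕ) : Type := Option (Bool × (Fin d → Bool) × (Fin d → Bool))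

/-- The alphabets of the stacks of the model checker. -/
abbrev CheckerAlphabet (d : ℕ) : CheckerStack → Type
  | .inp => Option Bool
  | .out => Bool
  | .right => Letter d
  | .left => Letter d

/-- The finite memory of the transducers that the model checker runs on the work tape. -/
abbrev Flags : Type := Bool × Bool × Bool

/-- The registers of the model checker: the letter that was read last, and the flags. -/
abbrev CheckerReg (d : ℕ) : Type := Option (Letter d) × Flags

variable {d : ℕ}

/-- The stacks of the model checker with given contents. -/
def checkerStacks (i : List (Option Bool)) (o : List Bool) (r l : List (Letter d)) :
    ∀ k, List (CheckerAlphabet d k)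
  | .inp => i
  | .out => o
  | .right => r
  | .left => l

section
variable (i : List (Option Bool)) (o : List Bool) (r l : List (Letter d))

@[simp] theorem checkerStacks_inp : checkerStacks i o r l .inp = i := rfl
@[simp] theorem checkerStacks_out : checkerStacks i o r l .out = o := rfl
@[simp] theorem checkerStacks_right : checkerStacks i o r l .right = r := rfl
@[simp] theorem checkerStacks_left : checkerStacks i o r l .left = l := rfl

@[simp] theorem update_checkerStacks_inp (x) :
    Function.update (checkerStacks i o r l) .inp x = checkerStacks x o r l := by
  funext k; cases k <;> rfl
@[simp] theorem update_checkerStacks_out (x) :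
    Function.update (checkerStacks i o r l) .out x = checkerStacks i x r l := by
  funext k; cases k <;> rfl
@[simp] theorem update_checkerStacks_right (x) :
    Function.update (checkerStacks i o r l) .right x = checkerStacks i o x l := by
  funext k; cases k <;> rfl
@[simp] theorem update_checkerStacks_left (x) :
    Function.update (checkerStacks i o r l) .left x = checkerStacks i o r x := by
  funext k; cases k <;> rfl

end

/-- The statements of the model checker. -/
abbrev CheckerStmt (d : ℕ) : Type := Stmt (CheckerAlphabet d) Unit (CheckerReg d)

/-- The routines of the model checker. -/
abbrev CheckerRoutine (d : ℕ) : Type 1 := Routine (CheckerAlphabet d) (CheckerReg d)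

/-- The end of a statement: exit. -/
abbrev exitStmt : CheckerStmt d := .goto fun _ => ()

/-! ### Transducers on the work tape -/

/-- The run of a finite transducer on a word: the final state and the output word. -/
def transduce (δ : Flags → Letter d → Flags × Letter d) : Flags → List (Letter d) →
    Flags × List (Letter d)
  | q, [] => (q, [])
  | q, w :: l => ((transduce δ (δ q w).1 l).1, (δ q w).2 :: (transduce δ (δ q w).1 l).2)

theorem length_transduce (δ : Flags → Letter d → Flags × Letter d) (q : Flags)
    (l : List (Letter d)) : (transduce δ q l).2.length = l.length := by
  induction l generalizing q with
  | nil => rfl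
  | cons w l ih => simp [transduce, ih]

theorem transduce_append (δ : Flags → Letter d → Flags × Letter d) (q : Flags)
    (l l' : List (Letter d)) :
    transduce δ q (l ++ l') = ((transduce δ (transduce δ q l).1 l').1,
      (transduce δ q l).2 ++ (transduce δ (transduce δ q l).1 l').2) := by
  induction l generalizing q with
  | nil => rfl
  | cons w l ih => simp [transduce, ih]

/-- Read a letter from the right half of the work tape. -/
def readRight (c : CheckerStmt d) : CheckerStmt d := .pop .right (fun s x => (x, s.2)) c

/-- Read a letter from the left half of the work tape. -/
def readLeft (c : CheckerStmt d) : CheckerStmt d := .pop .left (fun s x => (x, s.2)) c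

/-- A register test: the last attempt to read a letter found one. -/
def gotLetter (s : CheckerReg d) : Bool := s.1.isSome

/-- Move the head to the left end of the tape, once the first letter on its left has been read. -/
def rewindLoop : CheckerRoutine d :=
  Routine.loop gotLetter <| Routine.single <| .push .right (fun s => s.1.getD none) <|
    readLeft exitStmt

theorem runs_rewindLoop (i : List (Option Bool)) (o : List Bool) (q : Flags)
    (r l : List (Letter d)) :
    rewindLoop.Runs ((l.head?, q), checkerStacks i o r l.tail)
      ((none, q), checkerStacks i o (l.reverse ++ r) []) (2 * l.length + 1) := by
  induction l generalizing r with
  | nil => exact Routine.runs_loop_of_false rfl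
  | cons w l ih =>
    have h := ih (w :: r)
    refine (Routine.runs_loop_of_true rfl
      (Routine.runs_single (s' := ((l.head?, q), checkerStacks i o (w :: r) l.tail)) ?_)
      (by simpa [rewindLoop] using h)).mono ?_
    · simp [readLeft]
    · simp; omega

/-- Apply a transducer to the word on the right of the head, once the first letter on its right has
been read. -/
def transduceLoop (δ : Flags → Letter d → Flags × Letter d) : CheckerRoutine d :=
  Routine.loop gotLetter <| Routine.single <| .push .left (fun s => (δ s.2 (s.1.getD none)).2) <|
    .load (fun s => (s.1, (δ s.2 (s.1.getD none)).1)) <| readRight exitStmt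

theorem runs_transduceLoop (δ : Flags → Letter d → Flags × Letter d) (i : List (Option Bool))
    (o : List Bool) (q : Flags) (r l : List (Letter d)) :
    (transduceLoop δ).Runs ((r.head?, q), checkerStacks i o r.tail l)
      ((none, (transduce δ q r).1), checkerStacks i o [] ((transduce δ q r).2.reverse ++ l))
      (2 * r.length + 1) := by
  induction r generalizing q l with
  | nil => exact Routine.runs_loop_of_false rfl
  | cons w r ih =>
    have h := ih (δ q w).1 ((δ q w).2 :: l)
    refine (Routine.runs_loop_of_true rfl
      (Routine.runs_single
        (s' := ((r.head?, (δ q w).1), checkerStacks i o r.tail ((δ q w).2 :: l))) ?_)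
      (by simpa [transduce, transduceLoop] using h)).mono ?_
    · simp [readRight]
    · simp; omega

/-- Run a transducer over the whole work tape, starting in the state `q₀`, rewrite the tape
and return to its left end; the final state of the transducer is left in the flags. -/
def passRoutine (q₀ : Flags) (δ : Flags → Letter d → Flags × Letter d) : CheckerRoutine d :=
  ((Routine.single <| .load (fun s => (s.1, q₀)) <| readRight exitStmt).seq
    (transduceLoop δ)).seq ((Routine.single <| readLeft exitStmt).seq rewindLoop)

theorem runs_passRoutine (q₀ : Flags) (δ : Flags → Letter d → Flags × Letter d)
    (i : List (Option Bool)) (o : List Bool) (s : CheckerReg d) (w : List (Letter d)) :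
    (passRoutine q₀ δ).Runs (s, checkerStacks i o w [])
      ((none, (transduce δ q₀ w).1), checkerStacks i o (transduce δ q₀ w).2 [])
      (4 * w.length + 4) := by
  have h := runs_rewindLoop i o (transduce δ q₀ w).1 [] (transduce δ q₀ w).2.reverse
  simp only [List.reverse_reverse, List.append_nil] at h
  have h' := runs_transduceLoop δ i o q₀ w []
  rw [List.append_nil] at h'
  refine (((Routine.runs_single ?_).seq h').seq ((Routine.runs_single ?_).seq h)).mono ?_
  · simp [readRight]
  · simp [readLeft]
  · simp [length_transduce]; omega

/-! ### Marked adjacency matrices -/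

/-- The row `i` of a marked adjacency matrix, without its end marker, from the column `s` on: `m` is
the row of the matrix, `ρ` the marks of the row, and `μ v j` tells whether the variable `v` has
the value `j`. -/
def tapeCells (m : ℕ → Bool) (ρ : Fin d → Bool) (μ : Fin d → ℕ → Bool) (s n : ℕ) :
    List (Letter d) :=
  (List.range' s n).map fun j => some (m j, ρ, fun v => μ v j)

/-- The contents of the work tape: the `n × n` matrix `A`, written row by row, where each cell
carries the variables whose value is its row and those whose value is its column. -/
def tapeWord (n : ℕ) (A : ℕ → ℕ → Bool) (μ : Fin d → ℕ → Bool) : List (Letter d) :=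
  (List.range' 0 n).flatMap fun i => tapeCells (A i) (fun v => μ v i) μ 0 n ++ [none]

theorem length_tapeWord (n : ℕ) (A : ℕ → ℕ → Bool) (μ : Fin d → ℕ → Bool) :
    (tapeWord n A μ).length = n * n + n := by
  simp [tapeWord, tapeCells, List.length_flatMap, mul_add]

theorem tapeWord_congr {n : ℕ} {A : ℕ → ℕ → Bool} {μ μ' : Fin d → ℕ → Bool}
    (h : ∀ v, ∀ i < n, μ v i = μ' v i) : tapeWord n A μ = tapeWord n A μ' := by
  have h' : ∀ i < n, (fun v => μ v i) = fun v => μ' v i := fun i hi => funext fun v => h v i hi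
  refine List.flatMap_congr fun i hi => ?_
  rw [h' i (by simpa using hi)]
  congr 1
  refine List.map_congr_left fun j hj => ?_
  rw [h' j (by simpa using hj)]

/-- Move the marks on the indices `0, 1, …` one place up, and mark the index `0` if `a` holds. -/
def shiftMark (a : Bool) (f : ℕ → Bool) : ℕ → Bool
  | 0 => a
  | i + 1 => f i

/-- The transducer that shifts the marks of the variable `k`. Its flags hold the mark that is due on
the current row, the mark that is due on the current cell, and the old mark of the current row. -/
def shiftStep (k : Fin d) (a : Bool) : Flags → Letter d → Flags × Letter d
  | (r, c, _), some (b, ρ, γ) =>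
    ((r, γ k, ρ k), some (b, Function.update ρ k r, Function.update γ k c))
  | (_, _, p), none => ((p, a, p), none)

theorem transduce_shiftStep_cells (k : Fin d) (a r p : Bool) (m : ℕ → Bool) (ρ : Fin d → Bool)
    (μ : Fin d → ℕ → Bool) (s n : ℕ) :
    transduce (shiftStep k a) (r, shiftMark a (μ k) s, p) (tapeCells m ρ μ s n) =
      ((r, shiftMark a (μ k) (s + n), if n = 0 then p else ρ k),
        tapeCells m (Function.update ρ k r) (Function.update μ k (shiftMark a (μ k))) s n) := by
  induction n generalizing s p with
  | zero => rfl
  | succ n ih =>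
    have h := ih (ρ k) (s + 1)
    simp only [tapeCells] at h
    simp only [tapeCells, List.range'_succ, List.map_cons, transduce, shiftStep]
    rw [show μ k s = shiftMark a (μ k) (s + 1) from rfl, h]
    simp only [add_assoc, add_comm 1 n, ite_self, Nat.add_eq_zero_iff, one_ne_zero, and_false,
      if_false, Prod.mk.injEq, true_and, List.cons.injEq, Option.some.injEq, and_true]
    funext v
    by_cases hv : v = k
    · subst hv; simp
    · simp [hv]

theorem transduce_shiftStep_rows (k : Fin d) (a p : Bool) (A : ℕ → ℕ → Bool)
    (μ : Fin d → ℕ → Bool) {n : ℕ} (hn : n ≠ 0) (s l : ℕ) :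
    (transduce (shiftStep k a) (shiftMark a (μ k) s, a, p)
      ((List.range' s l).flatMap fun i => tapeCells (A i) (fun v => μ v i) μ 0 n ++ [none])).2 =
      (List.range' s l).flatMap fun i =>
        tapeCells (A i) (fun v => Function.update μ k (shiftMark a (μ k)) v i)
          (Function.update μ k (shiftMark a (μ k))) 0 n ++ [none] := by
  induction l generalizing s p with
  | zero => rfl
  | succ l ih =>
    have h := transduce_shiftStep_cells k a (shiftMark a (μ k) s) p (A s) (fun v => μ v s) μ 0 n
    have h' := ih (μ k s) (s + 1)
    simp only [List.range'_succ, List.flatMap_cons, transduce_append]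
    rw [if_neg hn] at h
    rw [show (shiftMark a (μ k) s, a, p) = (shiftMark a (μ k) s, shiftMark a (μ k) 0, p) from rfl,
      h]
    simp only [transduce, shiftStep]
    rw [show μ k s = shiftMark a (μ k) (s + 1) from rfl] at h' ⊢
    rw [h']
    have : Function.update (fun v => μ v s) k (shiftMark a (μ k) s) =
        fun v => Function.update μ k (shiftMark a (μ k)) v s := by
      funext v
      by_cases hv : v = k
      · subst hv; simp
      · simp [hv]
    rw [this]

theorem transduce_shiftStep (k : Fin d) (a : Bool) (n : ℕ) (A : ℕ → ℕ → Bool)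
    (μ : Fin d → ℕ → Bool) :
    (transduce (shiftStep k a) (a, a, false) (tapeWord n A μ)).2 =
      tapeWord n A (Function.update μ k (shiftMark a (μ k))) := by
  rcases eq_or_ne n 0 with rfl | hn
  · rfl
  · exact transduce_shiftStep_rows k a false A μ hn 0 n

/-- The transducer that looks for a letter satisfying `f`. -/
def findStep (f : Letter d → Bool) : Flags → Letter d → Flags × Letter d
  | (r, c, p), w => ((r || f w, c, p), w)

theorem transduce_findStep (f : Letter d → Bool) (r c p : Bool) (l : List (Letter d)) :
    transduce (findStep f) (r, c, p) l = ((r || l.any f, c, p), l) := by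
  induction l generalizing r with
  | nil => simp [transduce]
  | cons w l ih => simp [transduce, findStep, ih, Bool.or_assoc]

/-- A test for cells; it fails on end markers. -/
def cellTest (f : Bool → (Fin d → Bool) → (Fin d → Bool) → Bool) : Letter d → Bool
  | some (b, ρ, γ) => f b ρ γ
  | none => false

theorem any_cellTest_tapeWord (f : Bool → (Fin d → Bool) → (Fin d → Bool) → Bool) (n : ℕ)
    (A : ℕ → ℕ → Bool) (μ : Fin d → ℕ → Bool) :
    (tapeWord n A μ).any (cellTest f) = true ↔
      ∃ i < n, ∃ j < n, f (A i j) (fun v => μ v i) (fun v => μ v j) = true := by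
  simp only [tapeWord, tapeCells, List.any_eq_true, List.mem_flatMap, List.mem_append,
    List.mem_map, List.mem_range'_1, List.mem_singleton]
  constructor
  · rintro ⟨x, ⟨i, hi, ⟨j, hj, rfl⟩ | rfl⟩, hx⟩
    · exact ⟨i, by omega, j, by omega, hx⟩
    · simp [cellTest] at hx
  · rintro ⟨i, hi, j, hj, h⟩
    exact ⟨_, ⟨i, by omega, .inl ⟨j, by omega, rfl⟩⟩, h⟩

/-! ### Routines on the work tape and on the truth values -/

/-- Shift the marks of the variable `k` on the work tape. -/
def shiftRoutine (k : Fin d) (a : Bool) : CheckerRoutine d :=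
  passRoutine (a, a, false) (shiftStep k a)

theorem runs_shiftRoutine (k : Fin d) (a : Bool) (i : List (Option Bool)) (o : List Bool)
    (n : ℕ) (A : ℕ → ℕ → Bool) (μ : Fin d → ℕ → Bool) (s : CheckerReg d) :
    ∃ s', (shiftRoutine k a).Runs (s, checkerStacks i o (tapeWord n A μ) [])
      (s', checkerStacks i o (tapeWord n A (Function.update μ k (shiftMark a (μ k)))) [])
      (4 * (n * n + n) + 4) := by
  have h := runs_passRoutine (a, a, false) (shiftStep k a) i o s (tapeWord n A μ)
  rw [transduce_shiftStep, length_tapeWord] at h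
  exact ⟨_, h⟩

/-- Find out whether some cell of the work tape satisfies `f`, and put the answer in the first
flag. -/
def findRoutine (f : Bool → (Fin d → Bool) → (Fin d → Bool) → Bool) : CheckerRoutine d :=
  passRoutine (false, false, false) (findStep (cellTest f))

theorem runs_findRoutine (f : Bool → (Fin d → Bool) → (Fin d → Bool) → Bool)
    (i : List (Option Bool)) (o : List Bool) (n : ℕ) (A : ℕ → ℕ → Bool) (μ : Fin d → ℕ → Bool)
    (s : CheckerReg d) :
    (findRoutine f).Runs (s, checkerStacks i o (tapeWord n A μ) [])
      ((none, (tapeWord n A μ).any (cellTest f), false, false),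
        checkerStacks i o (tapeWord n A μ) []) (4 * (n * n + n) + 4) := by
  have h := runs_passRoutine (false, false, false) (findStep (cellTest f)) i o s (tapeWord n A μ)
  rw [transduce_findStep, length_tapeWord] at h
  simpa [findRoutine] using h

/-- Push a truth value that depends on the registers. -/
def pushRoutine (f : CheckerReg d → Bool) : CheckerRoutine d :=
  Routine.single (.push .out f exitStmt)

theorem runs_pushRoutine (f : CheckerReg d → Bool) (i : List (Option Bool)) (o : List Bool)
    (r l : List (Letter d)) (s : CheckerReg d) :
    (pushRoutine f).Runs (s, checkerStacks i o r l) (s, checkerStacks i (f s :: o) r l) 1 :=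
  Routine.runs_single (by simp)

/-- Replace the last two truth values by the result of a Boolean operation. -/
def combineRoutine (op : Bool → Bool → Bool) : CheckerRoutine d :=
  Routine.single <| .pop .out (fun s x => (s.1, x.getD false, s.2.2)) <|
    .pop .out (fun s x => (s.1, op (x.getD false) s.2.1, s.2.2)) <|
    .push .out (fun s => s.2.1) exitStmt

theorem runs_combineRoutine (op : Bool → Bool → Bool) (i : List (Option Bool)) (o : List Bool)
    (x y : Bool) (r l : List (Letter d)) (s : CheckerReg d) :
    ∃ s', (combineRoutine op).Runs (s, checkerStacks i (y :: x :: o) r l)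
      (s', checkerStacks i (op x y :: o) r l) 1 :=
  ⟨(s.1, op x y, s.2.2), Routine.runs_single (by simp)⟩

/-! ### Checking a first-order formula -/

open FirstOrder Language

/-- The variable that a term of the language of graphs consists of, by its de Bruijn level. -/
def termLevel {m : ℕ} : Language.graph.Term (Empty ⊕ Fin m) → ℕ
  | .var (.inr i) => i
  | .var (.inl e) => e.elim
  | .func f _ => isEmptyElim f

/-- The number of nested quantifiers in a formula. -/
def quantifierDepth {m : ℕ} : Language.graph.BoundedFormula Empty m → ℕ
  | .falsum => 0
  | .equal _ _ => 0
  | .rel _ _ => 0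
  | .imp φ ψ => max (quantifierDepth φ) (quantifierDepth ψ)
  | .all φ => quantifierDepth φ + 1

/-- The test for cells that looks for evidence for an atomic formula `x ~ y`. -/
def adjTest (x y : Fin d) (b : Bool) (ρ γ : Fin d → Bool) : Bool := b && ρ x && γ y

/-- The test for cells that looks for evidence for an atomic formula `x = y`. -/
def eqTest (x y : Fin d) (_ : Bool) (_ γ : Fin d → Bool) : Bool := γ x && γ y

/-- The test for cells whether their row is the value of `x`. -/
def rowTest (x : Fin d) (_ : Bool) (ρ _ : Fin d → Bool) : Bool := ρ x

/-- The routine that decides a first-order formula in the graph on the work tape and pushes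
its truth value, provided that the values of the free variables are marked on the tape. A quantifier
is a loop in which the mark of its variable runs through the vertices. -/
def checkRoutine {m : ℕ} : Language.graph.BoundedFormula Empty m → CheckerRoutine (d + 1)
  | .falsum => pushRoutine fun _ => false
  | .equal t u =>
    (findRoutine (eqTest (Fin.ofNat (d + 1) (termLevel t)) (Fin.ofNat (d + 1) (termLevel u)))).seq
      (pushRoutine fun s => s.2.1)
  | .rel (l := 2) _ ts =>
    (findRoutine (adjTest (Fin.ofNat (d + 1) (termLevel (ts 0)))
      (Fin.ofNat (d + 1) (termLevel (ts 1))))).seq (pushRoutine fun s => s.2.1)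
  | .rel _ _ => pushRoutine fun _ => false
  | .imp φ ψ => ((checkRoutine φ).seq (checkRoutine ψ)).seq (combineRoutine fun a b => !a || b)
  | .all φ =>
    (((pushRoutine fun _ => true).seq (shiftRoutine (Fin.ofNat (d + 1) m) true)).seq
      (findRoutine (rowTest (Fin.ofNat (d + 1) m)))).seq <|
    Routine.loop (fun s => s.2.1) <|
      (((checkRoutine φ).seq (combineRoutine and)).seq
        (shiftRoutine (Fin.ofNat (d + 1) m) false)).seq
      (findRoutine (rowTest (Fin.ofNat (d + 1) m)))

open Classical in
/-- The adjacency matrix of a graph, with entries `false` outside its range. -/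
noncomputable def adjBool {n : ℕ} (G : SimpleGraph (Fin n)) (i j : ℕ) : Bool :=
  decide (∃ (hi : i < n) (hj : j < n), G.Adj ⟨i, hi⟩ ⟨j, hj⟩)

/-- The marks for the variables of levels below `m` with given values. -/
def valueMarks {m n : ℕ} (x : Fin m → Fin n) (v : Fin (d + 1)) (i : ℕ) : Bool :=
  if h : v.1 < m then decide ((x ⟨v, h⟩).1 = i) else false

theorem valueMarks_ofNat {m n : ℕ} (hm : m ≤ d + 1) (x : Fin m → Fin n) (v : Fin m) (i : ℕ) :
    valueMarks x (Fin.ofNat (d + 1) v) i = decide ((x v).1 = i) := by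
  have hv := v.2
  simp [valueMarks, Nat.mod_eq_of_lt (show v.1 < d + 1 by omega)]

theorem valueMarks_snoc {m n : ℕ} (hm : m < d + 1) (x : Fin m → Fin n) (t : Fin n) :
    valueMarks (d := d) (Fin.snoc x t) =
      Function.update (valueMarks x) (Fin.ofNat (d + 1) m) (fun i => decide (i = t)) := by
  have hk : (Fin.ofNat (d + 1) m).1 = m := by simp [Nat.mod_eq_of_lt hm]
  funext v i
  by_cases hv : v = Fin.ofNat (d + 1) m
  · rw [hv, Function.update_self]
    unfold valueMarks
    rw [dif_pos (by omega)]
    simp [Fin.snoc, Nat.mod_eq_of_lt hm, eq_comm]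
  · have hv' : v.1 ≠ m := fun h => hv (Fin.ext (h.trans hk.symm))
    rw [Function.update_of_ne hv]
    unfold valueMarks
    by_cases h : v.1 < m
    · rw [dif_pos h, dif_pos (by omega)]
      simp [Fin.snoc, h]
    · rw [dif_neg h, dif_neg (by omega)]

theorem any_rowTest (k : Fin d) (n t : ℕ) (A : ℕ → ℕ → Bool) (μ : Fin d → ℕ → Bool)
    (hμ : μ k = fun i => decide (i = t)) :
    (tapeWord n A μ).any (cellTest (rowTest k)) = decide (t < n) := by
  rw [Bool.eq_iff_iff, any_cellTest_tapeWord]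
  simp only [rowTest, hμ, decide_eq_true_eq]
  constructor
  · rintro ⟨i, hi, j, hj, rfl⟩; exact hi
  · intro h; exact ⟨t, h, t, h, rfl⟩

/-- If the routine `R` computes the truth value of `P t` when the variable `k` has the value `t`,
then the loop of a universal quantifier computes a conjunction. -/
theorem runs_quantifierLoop {R : CheckerRoutine d} {k : Fin d} {n T : ℕ} {A : ℕ → ℕ → Bool}
    {μ : Fin d → ℕ → Bool} {P : ℕ → Bool}
    (hR : ∀ t < n, ∀ o s, ∃ s', R.Runs
      (s, checkerStacks [] o (tapeWord n A (Function.update μ k fun i => decide (i = t))) [])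
      (s', checkerStacks [] (P t :: o)
        (tapeWord n A (Function.update μ k fun i => decide (i = t))) []) T)
    (j t : ℕ) (hj : t + j = n) (o : List Bool) (b b' : Bool) (s : CheckerReg d)
    (hs : s.2.1 = decide (t < n)) (hb : b' = true ↔ b = true ∧ ∀ i < n, t ≤ i → P i = true) :
    ∃ s', (Routine.loop (fun s => s.2.1) <|
      ((R.seq (combineRoutine and)).seq (shiftRoutine k false)).seq (findRoutine (rowTest k))).Runs
      (s, checkerStacks [] (b :: o) (tapeWord n A (Function.update μ k fun i => decide (i = t))) [])
      (s', checkerStacks [] (b' :: o)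
        (tapeWord n A (Function.update μ k fun i => decide (i = n))) [])
      (j * (T + 8 * (n * n + n) + 10) + 1) := by
  induction j generalizing t b s with
  | zero =>
    obtain rfl : t = n := hj
    have : b' = b := by
      rw [Bool.eq_iff_iff, hb]
      exact ⟨fun h => h.1, fun h => ⟨h, fun i hi hi' => absurd hi' (by omega)⟩⟩
    subst this
    exact ⟨s, (Routine.runs_loop_of_false (by simp [hs])).mono (by simp)⟩
  | succ j ih =>
    have ht : t < n := by omega
    obtain ⟨s₁, h₁⟩ := hR t ht (b :: o) s
    obtain ⟨s₂, h₂⟩ := runs_combineRoutine and [] o b (P t)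
      (tapeWord n A (Function.update μ k fun i => decide (i = t))) [] s₁
    obtain ⟨s₃, h₃⟩ := runs_shiftRoutine k false [] ((b && P t) :: o) n A
      (Function.update μ k fun i => decide (i = t)) s₂
    have hshift : Function.update (Function.update μ k fun i => decide (i = t)) k
        (shiftMark false (Function.update μ k (fun i => decide (i = t)) k)) =
        Function.update μ k fun i => decide (i = t + 1) := by
      rw [Function.update_idem, Function.update_self]
      congr 1
      funext i
      cases i <;> simp [shiftMark]
    rw [hshift] at h₃
    have h₄ := runs_findRoutine (rowTest k) [] ((b && P t) :: o) n A
      (Function.update μ k fun i => decide (i = t + 1)) s₃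
    rw [any_rowTest k n (t + 1) A _ (Function.update_self ..)] at h₄
    obtain ⟨s₅, h₅⟩ := ih (t + 1) (by omega) (b && P t) (none, decide (t + 1 < n), false, false) rfl
      (by
        rw [hb, Bool.and_eq_true, and_assoc]
        refine and_congr_right fun _ => ⟨fun h => ⟨h t ht le_rfl, fun i hi hi' =>
          h i hi (by omega)⟩, fun h i hi hi' => ?_⟩
        rcases hi'.eq_or_lt with rfl | hlt
        · exact h.1
        · exact h.2 i hi hlt)
    exact ⟨s₅, (Routine.runs_loop_of_true (by simp [hs, ht]) (((h₁.seq h₂).seq h₃).seq h₄)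
      h₅).mono (by ring_nf; omega)⟩

/-- The model checker is correct and runs in polynomial time. -/
theorem runs_checkRoutine {m : ℕ} (φ : Language.graph.BoundedFormula Empty m)
    (hφ : m + quantifierDepth φ ≤ d + 1) :
    ∃ p : Polynomial ℕ, ∀ (n : ℕ) (G : SimpleGraph (Fin n)) (x : Fin m → Fin n) (o : List Bool)
      (s : CheckerReg (d + 1)) (b : Bool), letI := G.structure
      (b = true ↔ φ.Realize default x) →
      ∃ s', (checkRoutine φ).Runs
        (s, checkerStacks [] o (tapeWord n (adjBool G) (valueMarks x)) [])
        (s', checkerStacks [] (b :: o) (tapeWord n (adjBool G) (valueMarks x)) [])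
        (p.eval (n * n + n)) := by
  induction φ with
  | falsum =>
    refine ⟨1, fun n G x o s b hb => ⟨s, ?_⟩⟩
    obtain rfl : b = false := by simpa [BoundedFormula.Realize] using hb
    simpa [checkRoutine] using runs_pushRoutine (fun _ => false) [] o
      (tapeWord n (adjBool G) (valueMarks x)) [] s
  | @equal m t u =>
    refine ⟨4 * Polynomial.X + 5, fun n G x o s b hb => ?_⟩
    let := G.structure
    obtain (⟨⟨⟩⟩ | i) | ⟨f, -⟩ := t
    swap; · exact isEmptyElim f
    obtain (⟨⟨⟩⟩ | j) | ⟨f, -⟩ := u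
    swap; · exact isEmptyElim f
    have hm : m ≤ d + 1 := by omega
    have h := ((runs_findRoutine (eqTest (Fin.ofNat (d + 1) i) (Fin.ofNat (d + 1) j)) [] o n
      (adjBool G) (valueMarks x) s).seq (runs_pushRoutine (fun s => s.2.1) [] o _ [] _))
    have hb' : (tapeWord n (adjBool G) (valueMarks x)).any
        (cellTest (eqTest (Fin.ofNat (d + 1) i) (Fin.ofNat (d + 1) j))) = b := by
      rw [Bool.eq_iff_iff, any_cellTest_tapeWord, hb]
      simp only [eqTest, valueMarks_ofNat hm, Bool.and_eq_true, decide_eq_true_eq]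
      simp only [BoundedFormula.Realize, Term.realize_var, Sum.elim_inr]
      constructor
      · rintro ⟨_, -, _, -, h, h'⟩
        exact Fin.ext (h.trans h'.symm)
      · intro h
        exact ⟨_, (x i).2, _, (x i).2, rfl, by rw [h]⟩
    rw [hb'] at h
    exact ⟨_, h.mono (by simp)⟩
  | @rel m l R ts =>
    refine ⟨4 * Polynomial.X + 5, fun n G x o s b hb => ?_⟩
    let := G.structure
    cases R
    rcases h0 : ts 0 with (⟨⟨⟩⟩ | i) | ⟨f, -⟩
    swap; · exact isEmptyElim f
    rcases h1 : ts 1 with (⟨⟨⟩⟩ | j) | ⟨f, -⟩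
    swap; · exact isEmptyElim f
    have hm : m ≤ d + 1 := by omega
    have h := ((runs_findRoutine (adjTest (Fin.ofNat (d + 1) i) (Fin.ofNat (d + 1) j)) [] o n
      (adjBool G) (valueMarks x) s).seq (runs_pushRoutine (fun s => s.2.1) [] o _ [] _))
    have hb' : (tapeWord n (adjBool G) (valueMarks x)).any
        (cellTest (adjTest (Fin.ofNat (d + 1) i) (Fin.ofNat (d + 1) j))) = b := by
      rw [Bool.eq_iff_iff, any_cellTest_tapeWord, hb]
      simp only [adjTest, valueMarks_ofNat hm, Bool.and_eq_true, decide_eq_true_eq, adjBool]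
      simp only [BoundedFormula.Realize, Structure.RelMap, h0, h1, Term.realize_var, Sum.elim_inr]
      constructor
      · rintro ⟨_, -, _, -, ⟨⟨_, _, h⟩, rfl⟩, rfl⟩
        exact h
      · intro h
        exact ⟨_, (x i).2, _, (x j).2, ⟨⟨_, _, h⟩, rfl⟩, rfl⟩
    rw [hb'] at h
    change ∃ s', (checkRoutine (BoundedFormula.rel Language.adj ts)).Runs _ _ _
    rw [checkRoutine, h0, h1]
    exact ⟨_, h.mono (by simp)⟩
  | imp φ ψ ihφ ihψ =>
    simp only [quantifierDepth] at hφ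
    obtain ⟨p, hp⟩ := ihφ (by omega)
    obtain ⟨q, hq⟩ := ihψ (by omega)
    refine ⟨p + q + 1, fun n G x o s b hb => ?_⟩
    let := G.structure
    classical
    obtain ⟨s₁, h₁⟩ := hp n G x o s (decide (φ.Realize default x)) (by simp)
    obtain ⟨s₂, h₂⟩ := hq n G x (decide (φ.Realize default x) :: o) s₁
      (decide (ψ.Realize default x)) (by simp)
    obtain ⟨s₃, h₃⟩ := runs_combineRoutine (fun a b => !a || b) [] o
      (decide (φ.Realize default x)) (decide (ψ.Realize default x))
      (tapeWord n (adjBool G) (valueMarks (d := d) x)) [] s₂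
    have hb' : (!decide (φ.Realize default x) || decide (ψ.Realize default x)) = b := by
      rw [Bool.eq_iff_iff, hb, BoundedFormula.realize_imp]
      by_cases h : φ.Realize default x <;> by_cases h' : ψ.Realize default x <;> simp [h, h']
    rw [hb'] at h₃
    exact ⟨s₃, ((h₁.seq h₂).seq h₃).mono (by simp)⟩
  | @all m φ ih =>
    simp only [quantifierDepth] at hφ
    obtain ⟨p, hp⟩ := ih (by omega)
    refine ⟨Polynomial.X * (p + 8 * Polynomial.X + 10) + 8 * Polynomial.X + 10,
      fun n G x o s b hb => ?_⟩
    let := G.structure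
    classical
    set k := Fin.ofNat (d + 1) m with hk
    set μ : Fin (d + 1) → ℕ → Bool := valueMarks x with hμ
    have hk' : k.1 = m := by simp [hk, Nat.mod_eq_of_lt (show m < d + 1 by omega)]
    have hblank : μ k = fun _ => false := by
      funext i
      simp [hμ, valueMarks, hk']
    obtain ⟨s₂, h₂⟩ := runs_shiftRoutine k true [] (true :: o) n (adjBool G) μ s
    have hshift : shiftMark true (μ k) = fun i => decide (i = 0) := by
      funext i
      rw [hblank]
      cases i <;> simp [shiftMark]
    rw [hshift] at h₂
    have h₃ := runs_findRoutine (rowTest k) [] (true :: o) n (adjBool G)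
      (Function.update μ k fun i => decide (i = 0)) s₂
    rw [any_rowTest k n 0 _ _ (Function.update_self ..)] at h₃
    have hend : tapeWord n (adjBool G) (Function.update μ k fun i => decide (i = n)) =
        tapeWord n (adjBool G) μ := by
      refine tapeWord_congr fun v i hi => ?_
      by_cases hv : v = k
      · rw [hv, Function.update_self, hblank]
        simp; omega
      · rw [Function.update_of_ne hv]
    obtain ⟨s₄, h₄⟩ := runs_quantifierLoop (R := checkRoutine φ) (k := k) (n := n)
      (A := adjBool G) (μ := μ) (T := p.eval (n * n + n))
      (P := fun t => decide (∃ h : t < n, φ.Realize default (Fin.snoc x ⟨t, h⟩)))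
      (fun t ht o s => by
        have := hp n G (Fin.snoc x ⟨t, ht⟩) o s
          (decide (∃ h : t < n, φ.Realize default (Fin.snoc x ⟨t, h⟩))) (by simp [ht])
        rw [valueMarks_snoc (by omega)] at this
        exact this) n 0 (by omega) o true b (none, decide (0 < n), false, false) rfl
      (by
        rw [hb, BoundedFormula.realize_all]
        simp only [decide_eq_true_eq, true_and, zero_le, true_implies]
        exact ⟨fun h i hi => ⟨hi, h _⟩, fun h a => (h a a.2).2⟩)
    rw [hend] at h₄
    refine ⟨s₄, (((((runs_pushRoutine (fun _ => true) [] o _ [] s).seq h₂).seq h₃).seq h₄)).mono ?_⟩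
    have hn : n ≤ n * n + n := Nat.le_add_left _ _
    have := Nat.mul_le_mul_right (p.eval (n * n + n) + 8 * (n * n + n) + 10) hn
    simp only [Polynomial.eval_add, Polynomial.eval_mul, Polynomial.eval_X, Polynomial.eval_ofNat]
    omega

/-! ### Decidability of first-order properties of graphs in polynomial time -/

/-- The letter of the work tape for a letter of the input: no variable has a value yet. -/
def toLetter (x : Option Bool) : Letter d := x.map fun b => (b, fun _ => false, fun _ => false)

/-- Read a letter of the input. -/
def readInput (c : CheckerStmt d) : CheckerStmt d :=
  .pop .inp (fun s x => (x.map toLetter, s.2)) c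

/-- Copy the input to the work tape, once its first letter has been read. -/
def copyLoop : CheckerRoutine d :=
  Routine.loop gotLetter <| Routine.single <| .push .left (fun s => s.1.getD none) <|
    readInput exitStmt

theorem runs_copyLoop (i : List (Option Bool)) (o : List Bool) (q : Flags)
    (r l : List (Letter d)) :
    copyLoop.Runs ((i.head?.map toLetter, q), checkerStacks i.tail o r l)
      ((none, q), checkerStacks [] o r ((i.map toLetter).reverse ++ l)) (2 * i.length + 1) := by
  induction i generalizing l with
  | nil => exact Routine.runs_loop_of_false rfl
  | cons x i ih =>
    have h := ih (toLetter x :: l)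
    refine (Routine.runs_loop_of_true rfl
      (Routine.runs_single
        (s' := ((i.head?.map toLetter, q), checkerStacks i.tail o r (toLetter x :: l))) ?_)
      (by simpa [copyLoop] using h)).mono ?_
    · simp [readInput]
    · simp; omega

/-- Move the input to the work tape. -/
def loadRoutine : CheckerRoutine d :=
  ((Routine.single <| readInput exitStmt).seq copyLoop).seq
    ((Routine.single <| readLeft exitStmt).seq rewindLoop)

theorem runs_loadRoutine (i : List (Option Bool)) (o : List Bool) (s : CheckerReg d) :
    loadRoutine.Runs (s, checkerStacks i o [] [])
      ((none, s.2), checkerStacks [] o (i.map toLetter) []) (4 * i.length + 4) := by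
  have h := runs_rewindLoop [] o s.2 [] (i.map (toLetter (d := d))).reverse
  simp only [List.reverse_reverse, List.append_nil] at h
  have h' := runs_copyLoop i o s.2 ([] : List (Letter d)) []
  rw [List.append_nil] at h'
  refine (((Routine.runs_single ?_).seq h').seq ((Routine.runs_single ?_).seq h)).mono ?_
  · simp [readInput]
  · simp [readLeft]
  · simp; omega

/-- Erase the work tape, once its first letter has been read. -/
def eraseLoop : CheckerRoutine d :=
  Routine.loop gotLetter <| Routine.single <| readRight exitStmt

theorem runs_eraseLoop (i : List (Option Bool)) (o : List Bool) (q : Flags)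
    (r l : List (Letter d)) :
    eraseLoop.Runs ((r.head?, q), checkerStacks i o r.tail l)
      ((none, q), checkerStacks i o [] l) (2 * r.length + 1) := by
  induction r with
  | nil => exact Routine.runs_loop_of_false rfl
  | cons x r ih =>
    refine (Routine.runs_loop_of_true rfl
      (Routine.runs_single
        (s' := ((r.head?, q), checkerStacks i o r.tail l)) ?_)
      (by simpa [eraseLoop] using ih)).mono ?_
    · simp [readRight]
    · simp; omega

/-- The initial values of the registers. -/
def initialReg : CheckerReg d := (none, false, false, false)

/-- Erase the work tape and reset the registers. -/
def eraseRoutine : CheckerRoutine d :=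
  ((Routine.single <| readRight exitStmt).seq eraseLoop).seq
    (Routine.single <| .load (fun _ => initialReg) exitStmt)

theorem runs_eraseRoutine (i : List (Option Bool)) (o : List Bool) (s : CheckerReg d)
    (r l : List (Letter d)) :
    eraseRoutine.Runs (s, checkerStacks i o r l) (initialReg, checkerStacks i o [] l)
      (2 * r.length + 3) := by
  refine (((Routine.runs_single ?_).seq (runs_eraseLoop i o s.2 r l)).seq
    (Routine.runs_single ?_)).mono ?_
  · simp [readRight]
  · simp
  · omega

theorem map_toLetter_encodeGraph (G : InputGraph) (x : Fin 0 → Fin G.1) :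
    (encodeGraph G).map toLetter = tapeWord G.1 (adjBool G.2) (valueMarks (d := d) x) := by
  obtain ⟨n, G⟩ := G
  have hr : List.range' 0 n = (List.finRange n).map Fin.val := by
    rw [List.map_coe_finRange_eq_range, List.range_eq_range']
  simp only [encodeGraph, tapeWord, tapeCells, hr, List.map_flatMap, List.flatMap_map,
    List.map_append, List.map_map, List.map_cons, List.map_nil]
  refine List.flatMap_congr fun i _ => ?_
  congr 1
  refine List.map_congr_left fun j _ => ?_
  simp [toLetter, adjBool, valueMarks]

theorem length_encodeGraph (G : InputGraph) : (encodeGraph G).length = G.1 * G.1 + G.1 := by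
  simp [encodeGraph, List.length_flatMap, mul_add]

/-- The routine that decides a sentence in a graph given by its adjacency matrix. -/
def sentenceRoutine (φ : Language.graph.Sentence) : CheckerRoutine (quantifierDepth φ + 1) :=
  (loadRoutine.seq (checkRoutine φ)).seq eraseRoutine

/-- The Turing machine that decides a sentence in a graph given by its adjacency matrix. -/
def sentenceMachine (φ : Language.graph.Sentence) : FinTM2 :=
  letI := (sentenceRoutine φ).fintypeLabel
  { K := CheckerStack
    k₀ := .inp
    k₁ := .out
    Γ := CheckerAlphabet (quantifierDepth φ + 1)
    Λ := Option (sentenceRoutine φ).Label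
    main := some (sentenceRoutine φ).entry
    σ := CheckerReg (quantifierDepth φ + 1)
    initialState := initialReg
    Γk₀Fin := inferInstanceAs (Fintype (Option Bool))
    m := fun
      | none => .halt
      | some l => (sentenceRoutine φ).code l }

theorem sentenceMachine_outputs (φ : Language.graph.Sentence) :
    ∃ p : Polynomial ℕ, ∀ (G : InputGraph) (b : Bool), letI := G.2.structure
      (b = true ↔ Fin G.1 ⊨ φ) →
      Nonempty (TM2OutputsInTime (sentenceMachine φ) (encodeGraph G) (some [b])
        (p.eval (encodeGraph G).length)) := by
  obtain ⟨p, hp⟩ := runs_checkRoutine (d := quantifierDepth φ) φ (by omega)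
  refine ⟨p + 6 * Polynomial.X + 8, fun G b hb => ?_⟩
  let := G.2.structure
  have h₁ := runs_loadRoutine (d := quantifierDepth φ + 1) (encodeGraph G) [] initialReg
  rw [map_toLetter_encodeGraph G default] at h₁
  obtain ⟨s₂, h₂⟩ := hp G.1 G.2 default [] (none, initialReg.2) b hb
  have h₃ := runs_eraseRoutine [] [b] s₂
    (tapeWord G.1 (adjBool G.2) (valueMarks (d := quantifierDepth φ)
      (default : Fin 0 → Fin G.1))) []
  have h := ((h₁.seq h₂).seq h₃) (Option (sentenceRoutine φ).Label) (sentenceMachine φ).m some none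
    (fun l => by
      have : (fun o : Option (sentenceRoutine φ).Label => o.elim none some) = id := by
        funext o; cases o <;> rfl
      exact ((congrArg (fun f => Stmt.mapLabel f ((sentenceRoutine φ).code l)) this).trans
        (Stmt.mapLabel_id _)).symm)
  obtain ⟨t, ht, h⟩ := h.trans ReachesIn.single
  have hinit : initList (sentenceMachine φ) (encodeGraph G) =
      ⟨some (some (sentenceRoutine φ).entry), initialReg, checkerStacks (encodeGraph G) [] [] []⟩ :=
    congrArg (TM2.Cfg.mk _ _) (by funext k; cases k <;> rfl)
  have hhalt : haltList (sentenceMachine φ) [b] =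
      ⟨none, initialReg, checkerStacks [] [b] [] []⟩ :=
    congrArg (TM2.Cfg.mk _ _) (by funext k; cases k <;> rfl)
  refine ⟨⟨t, ?_⟩, ?_⟩
  · rw [hinit]
    exact h.trans (congrArg some hhalt.symm)
  · refine ht.trans ?_
    rw [length_tapeWord, length_encodeGraph]
    simp; omega

open Classical in
/-- **A property of graphs that is defined by a first-order sentence, on a class of graphs, can be
decided in polynomial time on that class.** -/
theorem decidableInPolyTimeOn_of_sentence {C P : InputGraph → Prop} (φ : Language.graph.Sentence)
    (h : ∀ G : InputGraph, C G → letI := G.2.structure; P G ↔ Fin G.1 ⊨ φ) :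
    DecidableInPolyTimeOn C P := by
  obtain ⟨p, hp⟩ := sentenceMachine_outputs φ
  refine ⟨⟨⟨sentenceMachine φ, Equiv.refl _, Equiv.refl _⟩, p, fun G => ?_⟩⟩
  refine Classical.choice ?_
  have := hp G.1 (decide (P G.1)) (by simpa using h G.1 G.2)
  have e : List.map (Equiv.refl (Option Bool)).invFun (encodeGraph G.1) = encodeGraph G.1 :=
    List.map_id _
  rw [← e] at this
  rw [List.length_map] at this
  exact this

end ModelChecker

/-! ### Leaves, support vertices and core vertices -/

section Core

variable {V : Type*} (G : SimpleGraph V)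

/-- A leaf: a vertex of degree one. -/
def IsLeaf (v : V) : Prop := ∃ u, G.Adj v u ∧ ∀ w, G.Adj v w → w = u

/-- The vertex `v` is adjacent to a leaf. -/
def HasLeaf (v : V) : Prop := ∃ l, G.Adj v l ∧ IsLeaf G l

/-- The vertex `v` has degree at least two. -/
def IsBranching (v : V) : Prop := ∃ a b, a ≠ b ∧ G.Adj v a ∧ G.Adj v b

/-- A core vertex: a vertex of degree at least two that is not adjacent to a leaf. -/
def IsCore (v : V) : Prop := IsBranching G v ∧ ¬ HasLeaf G v

/-- A support vertex: a vertex of degree at least two that is adjacent to a leaf. -/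
def IsSupport (v : V) : Prop := IsBranching G v ∧ HasLeaf G v

/-- There are no closed walks of length 3, 5 or 7, and no cycles of length 4. -/
structure HasNoShortCycles : Prop where
  no3 : ∀ a b c, G.Adj a b → G.Adj b c → G.Adj c a → False
  no4 : ∀ a b c d, G.Adj a b → G.Adj b c → G.Adj c d → G.Adj d a → a = c ∨ b = d
  no5 : ∀ a b c d e, G.Adj a b → G.Adj b c → G.Adj c d → G.Adj d e → G.Adj e a → False
  no7 : ∀ a b c d e f g, G.Adj a b → G.Adj b c → G.Adj c d → G.Adj d e → G.Adj e f →
    G.Adj f g → G.Adj g a → False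

variable {G}

theorem isLeaf_of_adj_of_not_isBranching {v u : V} (h : G.Adj v u) (hv : ¬ IsBranching G v) :
    IsLeaf G v :=
  ⟨u, h, fun w hw => by_contra fun hne => hv ⟨w, u, hne, hw, h⟩⟩

theorem IsBranching.not_isLeaf {v : V} (h : IsBranching G v) : ¬ IsLeaf G v := by
  rintro ⟨u, -, hu⟩
  obtain ⟨a, b, hab, ha, hb⟩ := h
  exact hab ((hu a ha).trans (hu b hb).symm)

theorem IsCore.isBranching_of_adj {v u : V} (h : IsCore G v) (hvu : G.Adj v u) :
    IsBranching G u :=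
  by_contra fun hu => h.2 ⟨u, hvu, isLeaf_of_adj_of_not_isBranching hvu.symm hu⟩

theorem isIndepSet_iff_forall_not_adj {s : Set V} :
    G.IsIndepSet s ↔ ∀ x ∈ s, ∀ y ∈ s, ¬ G.Adj x y :=
  ⟨fun h _ hx _ hy hxy => h hx hy hxy.ne hxy, fun h _ hx _ hy _ => h _ hx _ hy⟩

/-- A closed walk without repeated vertices and chords is an induced cycle. -/
theorem isIndContained_cycleGraph {n : ℕ} {f : Fin (n + 2) → V}
    (h₁ : ∀ i, G.Adj (f i) (f (i + 1)))
    (h₂ : ∀ i j, i ≠ j → i + 1 ≠ j → j + 1 ≠ i → f i ≠ f j ∧ ¬ G.Adj (f i) (f j)) :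
    (cycleGraph (n + 2)).IsIndContained G := by
  have hinj : Function.Injective f := by
    intro i j hij
    by_contra hne
    by_cases h : i + 1 = j
    · subst h; exact (h₁ i).ne hij
    by_cases h' : j + 1 = i
    · subst h'; exact (h₁ j).ne hij.symm
    exact (h₂ i j hne h h').1 hij
  refine ⟨⟨⟨f, hinj⟩, fun {i j} => ?_⟩⟩
  simp only [Function.Embedding.coeFn_mk, cycleGraph_adj, sub_eq_iff_eq_add, add_comm (1 : Fin _)]
  constructor
  · intro h
    by_contra! hne
    exact (h₂ i j (fun hij => h.ne (congrArg f hij)) hne.2.symm hne.1.symm).2 h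
  · rintro (rfl | rfl)
    · exact (h₁ j).symm
    · exact h₁ i

/-- The cycles of length 3, 4, 5 and 7 in a graph without induced ones can have no chord, and a
degenerate closed walk of odd length contains a shorter one. -/
theorem IsC3C4C5C7Free.hasNoShortCycles (h : IsC3C4C5C7Free G) : HasNoShortCycles G := by
  have no3 : ∀ a b c, G.Adj a b → G.Adj b c → G.Adj c a → False := by
    intro a b c hab hbc hca
    refine h 3 (by simp) (isIndContained_cycleGraph (f := ![a, b, c]) ?_ ?_)
    · intro i; fin_cases i <;> assumption
    · intro i j hij hij' hji
      exact ((show ∀ i j : Fin 3, i ≠ j → i + 1 ≠ j → j + 1 ≠ i → False by decide)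
        i j hij hij' hji).elim
  have no4 : ∀ a b c d, G.Adj a b → G.Adj b c → G.Adj c d → G.Adj d a → a = c ∨ b = d := by
    intro a b c d hab hbc hcd hda
    by_contra! hne
    have hac : ¬ G.Adj a c := fun h => no3 a b c hab hbc h.symm
    have hbd : ¬ G.Adj b d := fun h => no3 b c d hbc hcd h.symm
    refine h 4 (by simp) (isIndContained_cycleGraph (f := ![a, b, c, d]) ?_ ?_)
    · intro i; fin_cases i <;> assumption
    · intro i j hij hij' hji
      have hj : j = i + 2 := by revert i j; decide
      subst hj
      fin_cases i
      · exact ⟨hne.1, hac⟩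
      · exact ⟨hne.2, hbd⟩
      · exact ⟨hne.1.symm, fun h => hac h.symm⟩
      · exact ⟨hne.2.symm, fun h => hbd h.symm⟩
  have no5 : ∀ f : Fin 5 → V, (∀ i, G.Adj (f i) (f (i + 1))) → False := by
    intro f hf
    have h2 : ∀ i, f i ≠ f (i + 2) ∧ ¬ G.Adj (f i) (f (i + 2)) := by
      intro i
      have e₀ := hf i
      have e₁ := hf (i + 1)
      have e₂ := hf (i + 2)
      have e₃ := hf (i + 3)
      have e₄ := hf (i + 4)
      simp only [add_assoc, Fin.reduceAdd] at e₁ e₂ e₃ e₄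
      rw [add_zero] at e₄
      exact ⟨fun heq => no3 _ _ _ (heq ▸ e₂) e₃ e₄, fun hadj => no3 _ _ _ e₀ e₁ hadj.symm⟩
    refine h 5 (by simp) (isIndContained_cycleGraph hf fun i j hij hij' hji => ?_)
    have hj : j = i + 2 ∨ i = j + 2 := by clear h2 hf; revert i j; decide
    rcases hj with rfl | rfl
    · exact h2 i
    · exact ⟨(h2 j).1.symm, fun h => (h2 j).2 h.symm⟩
  have no5' : ∀ a b c d e, G.Adj a b → G.Adj b c → G.Adj c d → G.Adj d e → G.Adj e a → False :=
    fun a b c d e hab hbc hcd hde hea =>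
      no5 ![a, b, c, d, e] (by intro i; fin_cases i <;> assumption)
  have no7 : ∀ f : Fin 7 → V, (∀ i, G.Adj (f i) (f (i + 1))) → False := by
    intro f hf
    have h2 : ∀ i, (f i ≠ f (i + 2) ∧ ¬ G.Adj (f i) (f (i + 2))) ∧
        (f i ≠ f (i + 3) ∧ ¬ G.Adj (f i) (f (i + 3))) := by
      intro i
      have e₀ := hf i
      have e₁ := hf (i + 1)
      have e₂ := hf (i + 2)
      have e₃ := hf (i + 3)
      have e₄ := hf (i + 4)
      have e₅ := hf (i + 5)
      have e₆ := hf (i + 6)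
      simp only [add_assoc, Fin.reduceAdd] at e₁ e₂ e₃ e₄ e₅ e₆
      rw [add_zero] at e₆
      exact ⟨⟨fun heq => no5' _ _ _ _ _ (heq ▸ e₂) e₃ e₄ e₅ e₆,
        fun hadj => no3 _ _ _ e₀ e₁ hadj.symm⟩,
        fun heq => no3 _ _ _ e₀ e₁ (heq ▸ e₂), fun hadj => no5' _ _ _ _ _ hadj e₃ e₄ e₅ e₆⟩
    refine h 7 (by simp) (isIndContained_cycleGraph hf fun i j hij hij' hji => ?_)
    have hj : (j = i + 2 ∨ i = j + 2) ∨ (j = i + 3 ∨ i = j + 3) := by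
      clear h2 hf; revert i j; decide
    rcases hj with (rfl | rfl) | (rfl | rfl)
    · exact (h2 i).1
    · exact ⟨(h2 j).1.1.symm, fun h => (h2 j).1.2 h.symm⟩
    · exact (h2 i).2
    · exact ⟨(h2 j).2.1.symm, fun h => (h2 j).2.2 h.symm⟩
  exact ⟨no3, no4, no5', fun a b c d e f g hab hbc hcd hde hef hfg hga =>
    no7 ![a, b, c, d, e, f, g] (by intro i; fin_cases i <;> assumption)⟩

variable [Fintype V] [DecidableEq V]

/-- If the independent set `A` can replace the independent set `B` in a maximal independent set
as far as the vertices that are not adjacent to leaves are concerned, then the difference of their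
sizes is bounded by the independence gap: a neighbor of `A` that is not dominated by `B` can be
dominated by its leaf. -/
theorem card_le_card_add_independenceGap {A B : Finset V} (hA : ∀ x ∈ A, ∀ y ∈ A, ¬ G.Adj x y)
    (hB : ∀ x ∈ B, ∀ y ∈ B, ¬ G.Adj x y) (hB2 : ∀ b ∈ B, IsBranching G b)
    (hAl : ∀ a ∈ A, ¬ HasLeaf G a)
    (hdom : ∀ a ∈ A, ∀ y, (y = a ∨ G.Adj a y) → (∃ b ∈ B, b = y ∨ G.Adj b y) ∨ HasLeaf G y) :
    A.card ≤ B.card + independenceGap G := by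
  classical
  let S : Finset V := Finset.univ.filter fun l => IsLeaf G l ∧ ∃ p, G.Adj l p ∧
    (∃ a ∈ A, G.Adj a p) ∧ ¬ ∃ b ∈ B, b = p ∨ G.Adj b p
  have hSspec : ∀ l ∈ S, IsLeaf G l ∧ ∃ p, G.Adj l p ∧ (∀ w, G.Adj l w → w = p) ∧
      (∃ a ∈ A, G.Adj a p) ∧ ¬ ∃ b ∈ B, b = p ∨ G.Adj b p := by
    intro l hl
    obtain ⟨hl, p, hlp, hp⟩ := (Finset.mem_filter.1 hl).2
    refine ⟨hl, p, hlp, ?_, hp⟩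
    obtain ⟨u, hu, hu'⟩ := hl
    intro w hw
    rw [hu' w hw, hu' p hlp]
  have hBS : ∀ x ∈ B ∪ S, ∀ y ∈ S, ¬ G.Adj x y := by
    intro x hx y hy hxy
    obtain ⟨hyl, p, hyp, hyu, ⟨a, ha, hap⟩, hp⟩ := hSspec y hy
    obtain rfl := hyu x hxy.symm
    rcases Finset.mem_union.1 hx with hx | hx
    · exact hp ⟨x, hx, .inl rfl⟩
    · obtain ⟨hxl, -⟩ := hSspec x hx
      exact hAl a ha ⟨x, hap, hxl⟩
  have hAS : ∀ x ∈ A, ∀ y ∈ S, x ≠ y ∧ ¬ G.Adj x y := by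
    intro x hx y hy
    obtain ⟨hyl, p, hyp, hyu, ⟨a, ha, hap⟩, hp⟩ := hSspec y hy
    have hpl : HasLeaf G p := ⟨y, hyp.symm, hyl⟩
    refine ⟨?_, fun hxy => hAl x hx (hyu x hxy.symm ▸ hpl)⟩
    rintro rfl
    obtain ⟨b, hb, hbx⟩ | ⟨l, hl, hll⟩ := hdom x hx x (.inl rfl)
    · rcases hbx with rfl | hbx
      · exact (hB2 b hb).not_isLeaf hyl
      · exact hp ⟨b, hb, .inl (hyu b hbx.symm)⟩
    · exact hAl x hx ⟨l, hl, hll⟩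
  obtain ⟨I, hI, hImax⟩ := Finite.exists_le_maximal
    (p := fun t : Finset V => G.IsIndepSet t) (a := B ∪ S) (by
      rw [isIndepSet_iff_forall_not_adj]
      intro x hx y hy hxy
      rcases Finset.mem_union.1 hy with hy' | hy'
      · rcases Finset.mem_union.1 hx with hx' | hx'
        · exact hB x hx' y hy' hxy
        · exact hBS y hy x hx' hxy.symm
      · exact hBS x hx y hy' hxy)
  have hIind := isIndepSet_iff_forall_not_adj.1 hImax.prop
  -- An element of `I \ B` is neither in `A` nor adjacent to `A`, as `B ∪ S` dominates such
  -- vertices.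
  have hkey : ∀ x ∈ A, ∀ y ∈ I \ B, ¬ (y = x ∨ G.Adj x y) := by
    intro x hx y hy hxy
    obtain ⟨hyI, hyB⟩ := Finset.mem_sdiff.1 hy
    by_cases hBy : ∃ b ∈ B, b = y ∨ G.Adj b y
    · obtain ⟨b, hb, rfl | hby⟩ := hBy
      · exact hyB hb
      · exact hIind b (hI (Finset.mem_union_left _ hb)) y hyI hby
    · obtain ⟨l, hl, hll⟩ := (hdom x hx y hxy).resolve_left hBy
      rcases hxy with rfl | hxy
      · exact hAl y hx ⟨l, hl, hll⟩
      · have hlS : l ∈ S := Finset.mem_filter.2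
          ⟨Finset.mem_univ _, hll, y, hl.symm, ⟨x, hx, hxy⟩, hBy⟩
        exact hIind y hyI l (hI (Finset.mem_union_right _ hlS)) hl
  have hM : G.IsIndepSet ((A ∪ I \ B : Finset V) : Set V) := by
    rw [isIndepSet_iff_forall_not_adj]
    intro x hx y hy hxy
    rcases Finset.mem_union.1 hx with hx | hx <;> rcases Finset.mem_union.1 hy with hy | hy
    · exact hA x hx y hy hxy
    · exact hkey x hx y hy (.inr hxy)
    · exact hkey y hy x hx (.inr hxy.symm)
    · exact hIind x (Finset.mem_sdiff.1 hx).1 y (Finset.mem_sdiff.1 hy).1 hxy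
  have hMcard := hM.card_le_indepNum
  rw [Finset.card_union_of_disjoint (Finset.disjoint_left.2 fun x hx hx' =>
    hkey x hx x hx' (.inl rfl)), Finset.card_sdiff_of_subset
      (Finset.subset_union_left.trans hI)] at hMcard
  have hBI := Finset.card_le_card (Finset.subset_union_left.trans hI)
  have hi : minMaximalIndepNum G ≤ I.card := Nat.sInf_le ⟨I, hImax, rfl⟩
  unfold independenceGap
  omega

/-! ### Gadgets -/

variable (G) in
/-- An exchange of the set `J` of core vertices for the set `K` of core vertices in a maximal
independent set that contains the set `P` of support vertices. -/
structure IsGadget (P J K : Finset V) : Prop where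
  support : ∀ p ∈ P, IsSupport G p
  core_left : ∀ x ∈ J, IsCore G x
  core_right : ∀ x ∈ K, IsCore G x
  indep_left : ∀ x ∈ P ∪ J, ∀ y ∈ P ∪ J, ¬ G.Adj x y
  indep_right : ∀ x ∈ K, ∀ y ∈ K, ¬ G.Adj x y
  dom : ∀ x ∈ K, ∀ y, IsCore G y → (y = x ∨ G.Adj x y) → ∃ b ∈ P ∪ J, b = y ∨ G.Adj b y

theorem IsGadget.card_le {P J K : Finset V} (h : IsGadget G P J K) :
    K.card ≤ J.card + independenceGap G := by
  choose! leaf hleaf using fun p (hp : p ∈ P) => (h.support p hp).2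
  have huniq : ∀ p ∈ P, ∀ w, G.Adj (leaf p) w → w = p := by
    intro p hp w hw
    obtain ⟨hadj, u, -, hu⟩ := hleaf p hp
    rw [hu w hw, hu p hadj.symm]
  have hcore : ∀ p ∈ P, ¬ IsBranching G (leaf p) := fun p hp hb =>
    hb.not_isLeaf (hleaf p hp).2
  have hPJ : Disjoint P J := Finset.disjoint_left.2 fun x hx hx' =>
    (h.core_left x hx').2 (h.support x hx).2
  have hKl : Disjoint K (P.image leaf) := Finset.disjoint_left.2 fun x hx hx' => by
    obtain ⟨p, hp, rfl⟩ := Finset.mem_image.1 hx'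
    exact hcore p hp (h.core_right _ hx).1
  have hinj : Set.InjOn leaf P := fun p hp q hq hpq => by
    refine huniq q hq p ?_
    rw [← hpq]
    exact (hleaf p hp).1.symm
  have := card_le_card_add_independenceGap (G := G) (A := K ∪ P.image leaf) (B := P ∪ J)
    ?_ h.indep_left ?_ ?_ ?_
  · rw [Finset.card_union_of_disjoint hKl, Finset.card_union_of_disjoint hPJ,
      Finset.card_image_of_injOn hinj] at this
    omega
  · have hkl : ∀ x ∈ K, ∀ p ∈ P, ¬ G.Adj x (leaf p) := fun x hx p hp hxp =>
      (h.core_right x hx).2 ⟨_, hxp, (hleaf p hp).2⟩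
    intro x hx y hy hxy
    rcases Finset.mem_union.1 hx with hx | hx <;> rcases Finset.mem_union.1 hy with hy | hy
    · exact h.indep_right x hx y hy hxy
    · obtain ⟨p, hp, rfl⟩ := Finset.mem_image.1 hy
      exact hkl x hx p hp hxy
    · obtain ⟨p, hp, rfl⟩ := Finset.mem_image.1 hx
      exact hkl y hy p hp hxy.symm
    · obtain ⟨p, hp, rfl⟩ := Finset.mem_image.1 hx
      obtain ⟨q, hq, rfl⟩ := Finset.mem_image.1 hy
      exact hcore q hq (huniq p hp _ hxy ▸ (h.support p hp).1)
  · intro b hb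
    rcases Finset.mem_union.1 hb with hb | hb
    · exact (h.support b hb).1
    · exact (h.core_left b hb).1
  · intro a ha
    rcases Finset.mem_union.1 ha with ha | ha
    · exact (h.core_right a ha).2
    · obtain ⟨p, hp, rfl⟩ := Finset.mem_image.1 ha
      rintro ⟨l, hl, hll⟩
      exact (h.support p hp).1.not_isLeaf (huniq p hp l hl ▸ hll)
  · intro a ha y hy
    rcases Finset.mem_union.1 ha with ha | ha
    · by_cases hyl : HasLeaf G y
      · exact .inr hyl
      · refine .inl (h.dom a ha y ⟨?_, hyl⟩ hy)
        rcases hy with rfl | hy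
        · exact (h.core_right y ha).1
        · exact (h.core_right a ha).isBranching_of_adj hy
    · obtain ⟨p, hp, rfl⟩ := Finset.mem_image.1 ha
      refine .inl ⟨p, Finset.mem_union_left _ hp, ?_⟩
      rcases hy with rfl | hy
      · exact .inr (hleaf p hp).1
      · exact .inl (huniq p hp y hy).symm

/-- The exchange of a vertex `v` for a set `U` of core vertices adjacent to it. The other core
neighbors `w` of `U` have to be dominated by further vertices; as there are no short cycles, these
can be chosen arbitrarily. -/
theorem HasNoShortCycles.exists_star_gadget (hG : HasNoShortCycles G) {v : V}
    (hv : IsBranching G v) {U : Finset V} (hU : ∀ u ∈ U, IsCore G u ∧ G.Adj v u) :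
    ∃ P J K : Finset V, IsGadget G P J K ∧
      (HasLeaf G v → K.card = J.card + U.card) ∧
      (¬ HasLeaf G v → K.card + 1 = J.card + U.card) ∧
      (∀ x ∈ P ∪ J ∪ K, x = v ∨ x ∈ U ∨ ∃ u ∈ U, ∃ w, IsCore G w ∧ G.Adj u w ∧ G.Adj w x) ∧
      (¬ HasLeaf G v → ∀ W : Finset V,
        (∀ u ∈ U, ∀ w, IsCore G w → w ≠ v → G.Adj u w → w ∈ W) → P.card ≤ W.card) := by
  classical
  let W : Finset V := Finset.univ.filter fun w => IsCore G w ∧ w ≠ v ∧ ∃ u ∈ U, G.Adj u w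
  have hW : ∀ w ∈ W, ∃ x u, u ∈ U ∧ G.Adj u w ∧ G.Adj w x ∧ x ≠ u := by
    intro w hw
    obtain ⟨hwc, -, u, hu, huw⟩ := (Finset.mem_filter.1 hw).2
    obtain ⟨a, b, hab, ha, hb⟩ := hwc.1
    by_cases hau : a = u
    · exact ⟨b, u, hu, huw, hb, fun h => hab (hau.trans h.symm)⟩
    · exact ⟨a, u, hu, huw, ha, hau⟩
  choose! x c hxc using hW
  have hWc : ∀ w ∈ W, IsCore G w := fun w hw => (Finset.mem_filter.1 hw).2.1
  have hWv : ∀ w ∈ W, w ≠ v := fun w hw => (Finset.mem_filter.1 hw).2.2.1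
  let S : Finset V := W.image x
  have hS : ∀ y ∈ S, ∃ w ∈ W, ∃ u ∈ U, G.Adj u w ∧ G.Adj w y ∧ y ≠ u := by
    intro y hy
    obtain ⟨w, hw, rfl⟩ := Finset.mem_image.1 hy
    exact ⟨w, hw, c w, hxc w hw⟩
  have hSb : ∀ y ∈ S, IsBranching G y := fun y hy => by
    obtain ⟨w, hw, u, hu, huw, hwy, hyu⟩ := hS y hy
    exact (hWc w hw).isBranching_of_adj hwy
  have hSS : ∀ y ∈ S, ∀ y' ∈ S, ¬ G.Adj y y' := fun y hy y' hy' h => by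
    obtain ⟨w, hw, u, hu, huw, hwy, hyu⟩ := hS y hy
    obtain ⟨w', hw', u', hu', huw', hwy', hyu'⟩ := hS y' hy'
    exact hG.no7 v u w y y' w' u' (hU u hu).2 huw hwy h hwy'.symm huw'.symm (hU u' hu').2.symm
  have hSv : ∀ y ∈ S, ¬ G.Adj y v := fun y hy h => by
    obtain ⟨w, hw, u, hu, huw, hwy, hyu⟩ := hS y hy
    rcases hG.no4 v u w y (hU u hu).2 huw hwy h with h | h
    · exact hWv w hw h.symm
    · exact hyu h.symm
  have hSU : ∀ y ∈ S, ∀ u' ∈ U, ¬ G.Adj y u' := fun y hy u' hu' h => by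
    obtain ⟨w, hw, u, hu, huw, hwy, hyu⟩ := hS y hy
    exact hG.no5 v u w y u' (hU u hu).2 huw hwy h (hU u' hu').2.symm
  have hSU' : ∀ y ∈ S, y ∉ U := fun y hy hyU => by
    obtain ⟨w, hw, u, hu, huw, hwy, hyu⟩ := hS y hy
    rcases hG.no4 v u w y (hU u hu).2 huw hwy (hU y hyU).2.symm with h | h
    · exact hWv w hw h.symm
    · exact hyu h.symm
  have hvS : v ∉ S := fun h => by
    obtain ⟨w, hw, u, hu, huw, hwy, hyu⟩ := hS v h
    exact hG.no3 v u w (hU u hu).2 huw hwy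
  have hUU : ∀ u ∈ U, ∀ u' ∈ U, ¬ G.Adj u u' := fun u hu u' hu' h =>
    hG.no3 v u u' (hU u hu).2 h (hU u' hu').2.symm
  have hT : ∀ y ∈ insert v S, ∀ y' ∈ insert v S, ¬ G.Adj y y' := by
    intro y hy y' hy' h
    rcases Finset.mem_insert.1 hy with rfl | hy <;> rcases Finset.mem_insert.1 hy' with rfl | hy'
    · exact h.ne rfl
    · exact hSv y' hy' h.symm
    · exact hSv y hy h
    · exact hSS y hy y' hy' h
  have hTb : ∀ y ∈ insert v S, IsBranching G y := by
    intro y hy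
    rcases Finset.mem_insert.1 hy with rfl | hy
    · exact hv
    · exact hSb y hy
  have hPJ : (insert v S).filter (HasLeaf G) ∪ (insert v S).filter (fun y => ¬ HasLeaf G y) =
      insert v S := Finset.filter_union_filter_not_eq _ _
  have hK : (U ∪ S.filter fun y => ¬ HasLeaf G y).card =
      U.card + (S.filter fun y => ¬ HasLeaf G y).card :=
    Finset.card_union_of_disjoint (Finset.disjoint_left.2 fun y hy hy' =>
      hSU' y (Finset.mem_filter.1 hy').1 hy)
  refine ⟨(insert v S).filter (HasLeaf G), (insert v S).filter fun y => ¬ HasLeaf G y,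
    U ∪ S.filter fun y => ¬ HasLeaf G y, ⟨?_, ?_, ?_, ?_, ?_, ?_⟩, ?_, ?_, ?_, ?_⟩
  · intro p hp
    exact ⟨hTb p (Finset.mem_filter.1 hp).1, (Finset.mem_filter.1 hp).2⟩
  · intro p hp
    exact ⟨hTb p (Finset.mem_filter.1 hp).1, (Finset.mem_filter.1 hp).2⟩
  · intro y hy
    rcases Finset.mem_union.1 hy with hy | hy
    · exact (hU y hy).1
    · exact ⟨hSb y (Finset.mem_filter.1 hy).1, (Finset.mem_filter.1 hy).2⟩
  · rw [hPJ]; exact hT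
  · intro y hy y' hy' h
    rcases Finset.mem_union.1 hy with hy | hy <;> rcases Finset.mem_union.1 hy' with hy' | hy'
    · exact hUU y hy y' hy' h
    · exact hSU y' (Finset.mem_filter.1 hy').1 y hy h.symm
    · exact hSU y (Finset.mem_filter.1 hy).1 y' hy' h
    · exact hSS y (Finset.mem_filter.1 hy).1 y' (Finset.mem_filter.1 hy').1 h
  · rw [hPJ]
    intro y hy z hz hyz
    have hdomW : ∀ w ∈ W, ∃ b ∈ insert v S, b = w ∨ G.Adj b w := fun w hw =>
      ⟨x w, Finset.mem_insert_of_mem (Finset.mem_image_of_mem x hw), .inr (hxc w hw).2.2.1.symm⟩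
    rcases Finset.mem_union.1 hy with hy | hy
    · rcases hyz with rfl | hyz
      · exact ⟨v, Finset.mem_insert_self _ _, .inr (hU z hy).2⟩
      · by_cases hzv : z = v
        · exact ⟨v, Finset.mem_insert_self _ _, .inl hzv.symm⟩
        · exact hdomW z (Finset.mem_filter.2 ⟨Finset.mem_univ _, hz, hzv, y, hy, hyz⟩)
    · have hy' : y ∈ insert v S := Finset.mem_insert_of_mem (Finset.mem_filter.1 hy).1
      exact ⟨y, hy', hyz.imp Eq.symm id⟩
  · intro hl
    rw [hK, Finset.filter_insert, if_neg (not_not.2 hl), add_comm]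
  · intro hl
    rw [hK, Finset.filter_insert, if_pos hl, Finset.card_insert_of_notMem
      (fun h => hvS (Finset.mem_filter.1 h).1)]
    omega
  · rw [hPJ]
    intro y hy
    have hS' : y ∈ S → ∃ u ∈ U, ∃ w, IsCore G w ∧ G.Adj u w ∧ G.Adj w y := fun h => by
      obtain ⟨w, hw, u, hu, huw, hwy, hyu⟩ := hS y h
      exact ⟨u, hu, w, hWc w hw, huw, hwy⟩
    rcases Finset.mem_union.1 hy with hy | hy
    · rcases Finset.mem_insert.1 hy with hy | hy
      · exact .inl hy
      · exact .inr (.inr (hS' hy))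
    · rcases Finset.mem_union.1 hy with hy | hy
      · exact .inr (.inl hy)
      · exact .inr (.inr (hS' (Finset.mem_filter.1 hy).1))
  · intro hl W' hW'
    rw [Finset.filter_insert, if_neg hl]
    refine (Finset.card_filter_le _ _).trans (Finset.card_image_le.trans
      (Finset.card_le_card fun w hw => ?_))
    obtain ⟨hwc, hwv, u, hu, huw⟩ := (Finset.mem_filter.1 hw).2
    exact hW' u hu w hwc hwv huw

end Core

/-! ### The core of a graph of independence gap at most one -/

section CoreBound

variable {V : Type*} {G : SimpleGraph V}

variable (G) in
/-- The graph of the edges between core vertices. -/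
def coreGraph : SimpleGraph V where
  Adj a b := G.Adj a b ∧ IsCore G a ∧ IsCore G b
  symm := ⟨fun _ _ h => ⟨h.1.symm, h.2.2, h.2.1⟩⟩
  loopless := ⟨fun _ h => h.1.ne rfl⟩

variable (G) in
/-- The distance of `a` and `b` along core vertices is at most `k`. -/
def CoreNear (k : ℕ) (a b : V) : Prop := ∃ w : (coreGraph G).Walk a b, w.length ≤ k

theorem CoreNear.refl (a : V) : CoreNear G 0 a a := ⟨.nil, le_rfl⟩

theorem CoreNear.symm {k : ℕ} {a b : V} (h : CoreNear G k a b) : CoreNear G k b a :=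
  let ⟨w, hw⟩ := h
  ⟨w.reverse, by simpa using hw⟩

theorem CoreNear.trans {k l : ℕ} {a b c : V} (h : CoreNear G k a b) (h' : CoreNear G l b c) :
    CoreNear G (k + l) a c :=
  let ⟨w, hw⟩ := h
  let ⟨w', hw'⟩ := h'
  ⟨w.append w', by rw [Walk.length_append]; omega⟩

theorem CoreNear.mono {k l : ℕ} {a b : V} (h : CoreNear G k a b) (hkl : k ≤ l) :
    CoreNear G l a b :=
  let ⟨w, hw⟩ := h
  ⟨w, hw.trans hkl⟩

theorem CoreNear.of_adj {a b : V} (h : G.Adj a b) (ha : IsCore G a) (hb : IsCore G b) :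
    CoreNear G 1 a b :=
  ⟨.cons (show (coreGraph G).Adj a b from ⟨h, ha, hb⟩) .nil, le_rfl⟩

theorem isSupport_of_adj_of_not_isCore {v p : V} (hv : IsCore G v) (h : G.Adj v p)
    (hp : ¬ IsCore G p) : IsSupport G p := by
  have := hv.isBranching_of_adj h
  exact ⟨this, by_contra fun hl => hp ⟨this, hl⟩⟩

theorem exists_injOn_fin_two [DecidableEq V] {s : Finset V} (hs : s.card ≤ 2) :
    ∃ f : V → Fin 2, Set.InjOn f s := by
  obtain ⟨f⟩ : Nonempty (s ↪ Fin 2) := Function.Embedding.nonempty_of_card_le (by simpa using hs)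
  refine ⟨fun x => if h : x ∈ s then f ⟨x, h⟩ else 0, fun x hx y hy hxy => ?_⟩
  rw [Finset.mem_coe] at hx hy
  simpa [hx, hy] using hxy

variable [Fintype V]

open Classical in
variable (G) in
/-- The set of core vertices. -/
noncomputable def core : Finset V := Finset.univ.filter (IsCore G)

theorem mem_core {v : V} : v ∈ core G ↔ IsCore G v := by simp [core]

open Classical in
variable (G) in
/-- The core neighbors of a vertex. -/
noncomputable def coreNeighbors (v : V) : Finset V :=
  Finset.univ.filter fun u => IsCore G u ∧ G.Adj v u

theorem mem_coreNeighbors {v u : V} : u ∈ coreNeighbors G v ↔ IsCore G u ∧ G.Adj v u := by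
  simp [coreNeighbors]

variable [DecidableEq V]

/-- The exchange of a core vertex for its core neighbors gains at most one. -/
theorem card_coreNeighbors_le_two (hG : HasNoShortCycles G) (hgap : independenceGap G ≤ 1)
    {v : V} (hv : IsCore G v) : (coreNeighbors G v).card ≤ 2 := by
  obtain ⟨P, J, K, hg, -, h, -⟩ := hG.exists_star_gadget hv.1
    (U := coreNeighbors G v) fun u hu => mem_coreNeighbors.1 hu
  have := hg.card_le
  have := h hv.2
  omega

/-- A support vertex has at most one core neighbor: as it does not compete with its leaf, each core
neighbor contributes to the gain of the star gadget at it. -/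
theorem eq_of_adj_support (hG : HasNoShortCycles G) (hgap : independenceGap G ≤ 1)
    {p u u' : V} (hp : IsSupport G p) (hu : IsCore G u) (hu' : IsCore G u')
    (hpu : G.Adj p u) (hpu' : G.Adj p u') : u = u' := by
  obtain ⟨P, J, K, hg, h, -⟩ := hG.exists_star_gadget hp.1
    (U := coreNeighbors G p) fun u hu => mem_coreNeighbors.1 hu
  have h₁ := hg.card_le
  have h₂ := h hp.2
  exact Finset.card_le_one.1 (show (coreNeighbors G p).card ≤ 1 by omega) u
    (mem_coreNeighbors.2 ⟨hu, hpu⟩) u' (mem_coreNeighbors.2 ⟨hu', hpu'⟩)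

theorem exists_finset_coreNear (hG : HasNoShortCycles G) (hgap : independenceGap G ≤ 1)
    (k : ℕ) (a : V) : ∃ s : Finset V, s.card ≤ 3 ^ k ∧ ∀ b, CoreNear G k a b → b ∈ s := by
  induction k generalizing a with
  | zero =>
    refine ⟨{a}, by simp, ?_⟩
    rintro b ⟨w, hw⟩
    rw [Finset.mem_singleton]
    exact (Walk.eq_of_length_eq_zero (Nat.le_zero.1 hw)).symm
  | succ k ih =>
    choose s hs hs' using ih
    by_cases ha : IsCore G a
    · refine ⟨{a} ∪ (coreNeighbors G a).biUnion s, ?_, ?_⟩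
      · have h₁ := Finset.card_biUnion_le_card_mul (coreNeighbors G a) s (3 ^ k) fun c _ => hs c
        have h₂ := Nat.mul_le_mul_right (3 ^ k) (card_coreNeighbors_le_two hG hgap ha)
        have h₃ := Finset.card_union_le {a} ((coreNeighbors G a).biUnion s)
        have h₄ := Nat.one_le_pow k 3 (by norm_num)
        rw [Finset.card_singleton] at h₃
        rw [pow_succ]
        omega
      · rintro b ⟨w, hw⟩
        cases w with
        | nil => simp
        | @cons _ c _ h w =>
          refine Finset.mem_union_right _ (Finset.mem_biUnion.2
            ⟨c, mem_coreNeighbors.2 ⟨h.2.2, h.1⟩, hs' c b ⟨w, ?_⟩⟩)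
          simpa using hw
    · refine ⟨{a}, by simpa using Nat.one_le_pow _ 3 (by norm_num), ?_⟩
      rintro b ⟨w, hw⟩
      cases w with
      | nil => simp
      | cons h w => exact absurd h.2.1 ha

variable (G) in
/-- A gadget of gain one that involves only vertices near `v`. -/
def IsLocalGadget (v : V) (P J K : Finset V) : Prop :=
  IsGadget G P J K ∧ K.card = J.card + 1 ∧ P.card ≤ 2 ∧ (∀ x ∈ J ∪ K, CoreNear G 4 v x) ∧
    ∀ p ∈ P, ∃ r, IsCore G r ∧ G.Adj p r ∧ CoreNear G 4 v r

/-- The exchange of a core vertex with two core neighbors for these neighbors. -/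
theorem exists_isLocalGadget_of_near (hG : HasNoShortCycles G) (hgap : independenceGap G ≤ 1)
    {v c : V} (hc : IsCore G c) (hvc : CoreNear G 1 v c) (h2 : (coreNeighbors G c).card = 2) :
    ∃ P J K, IsLocalGadget G v P J K := by
  obtain ⟨P, J, K, hg, -, h, hloc, hP⟩ := hG.exists_star_gadget hc.1
    (U := coreNeighbors G c) fun u hu => mem_coreNeighbors.1 hu
  have hcard := h hc.2
  have hcore : ∀ x ∈ J ∪ K, IsCore G x := fun x hx =>
    (Finset.mem_union.1 hx).elim (hg.core_left x) (hg.core_right x)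
  have hu : ∀ u ∈ coreNeighbors G c, CoreNear G 2 v u := fun u hu =>
    hvc.trans (.of_adj (mem_coreNeighbors.1 hu).2 hc (mem_coreNeighbors.1 hu).1)
  have hw : ∀ u ∈ coreNeighbors G c, ∀ w, IsCore G w → G.Adj u w → CoreNear G 3 v w :=
    fun u hu' w hw huw => (hu u hu').trans (.of_adj huw (mem_coreNeighbors.1 hu').1 hw)
  refine ⟨P, J, K, hg, by omega, ?_, ?_, ?_⟩
  · refine (hP hc.2 ((coreNeighbors G c).biUnion fun u => (coreNeighbors G u).erase c) ?_).trans ?_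
    · intro u hu w hw hwc huw
      exact Finset.mem_biUnion.2
        ⟨u, hu, Finset.mem_erase.2 ⟨hwc, mem_coreNeighbors.2 ⟨hw, huw⟩⟩⟩
    · refine (Finset.card_biUnion_le_card_mul _ _ 1 fun u hu => ?_).trans (by omega)
      obtain ⟨huc, hcu⟩ := mem_coreNeighbors.1 hu
      rw [Finset.card_erase_of_mem (mem_coreNeighbors.2 ⟨hc, hcu.symm⟩)]
      have := card_coreNeighbors_le_two hG hgap huc
      omega
  · intro x hx
    have hx' : x ∈ P ∪ J ∪ K := by
      rw [Finset.union_assoc]; exact Finset.mem_union_right _ hx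
    rcases hloc x hx' with rfl | hxu | ⟨u, hu', w, hwc, huw, hwx⟩
    · exact hvc.mono (by norm_num)
    · exact (hu x hxu).mono (by norm_num)
    · exact (hw u hu' w hwc huw).trans (.of_adj hwx hwc (hcore x hx))
  · intro p hp
    have hpl := (hg.support p hp).2
    rcases hloc p (by simp [hp]) with rfl | hpu | ⟨u, hu', w, hwc, huw, hwx⟩
    · exact absurd hpl hc.2
    · exact absurd hpl (mem_coreNeighbors.1 hpu).1.2
    · exact ⟨w, hwc, hwx.symm, (hw u hu' w hwc huw).mono (by norm_num)⟩

theorem exists_isLocalGadget (hG : HasNoShortCycles G) (hgap : independenceGap G ≤ 1)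
    {v : V} (hv : IsCore G v) : ∃ P J K, IsLocalGadget G v P J K := by
  have hle := card_coreNeighbors_le_two hG hgap hv
  obtain h0 | h1 | h2 : (coreNeighbors G v).card = 0 ∨ (coreNeighbors G v).card = 1 ∨
    (coreNeighbors G v).card = 2 := by omega
  · -- A core vertex without core neighbors is dominated by any of its neighbors.
    have h0' : ∀ u, IsCore G u → ¬ G.Adj v u := fun u hu hvu => by
      have := mem_coreNeighbors.2 ⟨hu, hvu⟩
      rw [Finset.card_eq_zero.1 h0] at this
      simp at this
    obtain ⟨p, -, -, hp, -⟩ := hv.1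
    have hps := isSupport_of_adj_of_not_isCore hv hp fun h => h0' p h hp
    refine ⟨{p}, ∅, {v}, ⟨?_, ?_, ?_, ?_, ?_, ?_⟩, ?_, ?_, ?_, ?_⟩
    · simpa using hps
    · simp
    · simpa using hv
    · simp
    · simp
    · simp only [Finset.mem_singleton, Finset.union_empty, exists_eq_left]
      rintro x rfl y hy (rfl | hxy)
      · exact .inr hp.symm
      · exact absurd hxy (h0' y hy)
    · simp
    · simp
    · simpa using (CoreNear.refl v).mono (by norm_num)
    · simpa using ⟨v, hv, hp.symm, (CoreNear.refl v).mono (by norm_num)⟩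
  · obtain ⟨u, hu⟩ := Finset.card_eq_one.1 h1
    obtain ⟨huc, hvu⟩ := mem_coreNeighbors.1 (hu ▸ Finset.mem_singleton_self u)
    have hv1 : ∀ y, IsCore G y → G.Adj v y → y = u := fun y hy hvy => by
      have := mem_coreNeighbors.2 ⟨hy, hvy⟩
      rw [hu] at this
      simpa using this
    have hule := card_coreNeighbors_le_two hG hgap huc
    by_cases hu2 : (coreNeighbors G u).card = 2
    · exact exists_isLocalGadget_of_near hG hgap huc (.of_adj hvu hv huc) hu2
    -- Otherwise `u` and `v` have no other core neighbors. The two of them contribute one vertex to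
    -- a maximal independent set, or none when support vertices dominate both.
    have hu1 : ∀ y, IsCore G y → G.Adj u y → y = v := fun y hy huy =>
      Finset.card_le_one.1 (show (coreNeighbors G u).card ≤ 1 by omega) y
        (mem_coreNeighbors.2 ⟨hy, huy⟩) v (mem_coreNeighbors.2 ⟨hv, hvu.symm⟩)
    have hother : ∀ {a b : V}, IsCore G a → (∀ y, IsCore G y → G.Adj a y → y = b) →
        ∃ p, G.Adj a p ∧ IsSupport G p := by
      intro a b ha hab
      obtain ⟨x, y, hxy, hx, hy⟩ := ha.1
      by_cases hxb : x = b
      · exact ⟨y, hy, isSupport_of_adj_of_not_isCore ha hy fun h =>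
          hxy (hxb.trans (hab y h hy).symm)⟩
      · exact ⟨x, hx, isSupport_of_adj_of_not_isCore ha hx fun h => hxb (hab x h hx)⟩
    obtain ⟨p, hvp, hp⟩ := hother hv hv1
    obtain ⟨q, huq, hq⟩ := hother huc hu1
    have hpq : ¬ G.Adj p q := fun h => by
      rcases hG.no4 v u q p hvu huq h.symm hvp.symm with rfl | rfl
      · exact hv.2 hq.2
      · exact huc.2 hp.2
    refine ⟨{p, q}, ∅, {u}, ⟨?_, ?_, ?_, ?_, ?_, ?_⟩, ?_, ?_, ?_, ?_⟩
    · simp [hp, hq]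
    · simp
    · simpa using huc
    · simp [hpq, G.adj_comm q p]
    · simp
    · simp only [Finset.mem_singleton, Finset.union_empty, Finset.mem_insert, exists_eq_or_imp,
        exists_eq_left]
      rintro x rfl y hy (rfl | hxy)
      · exact .inr (.inr huq.symm)
      · rw [hu1 y hy hxy]
        exact .inl (.inr hvp.symm)
    · simp
    · exact Finset.card_le_two
    · simpa using (CoreNear.of_adj hvu hv huc).mono (by norm_num)
    · simp only [Finset.mem_insert, Finset.mem_singleton, forall_eq_or_imp, forall_eq]
      exact ⟨⟨v, hv, hvp.symm, (CoreNear.refl v).mono (by norm_num)⟩,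
        ⟨u, huc, huq.symm, (CoreNear.of_adj hvu hv huc).mono (by norm_num)⟩⟩
  · exact exists_isLocalGadget_of_near hG hgap hv ((CoreNear.refl v).mono (by norm_num)) h2

/-- Gadgets that are far from each other can be combined, to a gain of two, unless they use
adjacent support vertices. -/
theorem IsLocalGadget.exists_adj (hG : HasNoShortCycles G) (hgap : independenceGap G ≤ 1)
    {v v' : V} {P J K P' J' K' : Finset V} (h : IsLocalGadget G v P J K)
    (h' : IsLocalGadget G v' P' J' K') (hfar : ¬ CoreNear G 10 v v') :
    ∃ p ∈ P, ∃ q ∈ P', G.Adj p q := by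
  obtain ⟨hg, hc, -, hnear, hP⟩ := h
  obtain ⟨hg', hc', -, hnear', hP'⟩ := h'
  by_contra! hno
  have hdisj : ∀ x ∈ J ∪ K, x ∉ J' ∪ K' := fun x hx hx' =>
    hfar (((hnear x hx).trans (hnear' x hx').symm).mono (by norm_num))
  have hcore : ∀ x ∈ J ∪ K, IsCore G x := fun x hx =>
    (Finset.mem_union.1 hx).elim (hg.core_left x) (hg.core_right x)
  have hcore' : ∀ x ∈ J' ∪ K', IsCore G x := fun x hx =>
    (Finset.mem_union.1 hx).elim (hg'.core_left x) (hg'.core_right x)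
  have hnadj : ∀ x ∈ J ∪ K, ∀ y ∈ J' ∪ K', ¬ G.Adj x y := fun x hx y hy hxy =>
    hfar ((((hnear x hx).trans (.of_adj hxy (hcore x hx) (hcore' y hy))).trans
      (hnear' y hy).symm).mono (by norm_num))
  have hPJ : ∀ p ∈ P, ∀ y ∈ J' ∪ K', ¬ G.Adj p y := fun p hp y hy hpy => by
    obtain ⟨r, hr, hpr, hvr⟩ := hP p hp
    obtain rfl := eq_of_adj_support hG hgap (hg.support p hp) hr (hcore' y hy) hpr hpy
    exact hfar ((hvr.trans (hnear' r hy).symm).mono (by norm_num))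
  have hPJ' : ∀ p ∈ P', ∀ y ∈ J ∪ K, ¬ G.Adj p y := fun p hp y hy hpy => by
    obtain ⟨r, hr, hpr, hvr⟩ := hP' p hp
    obtain rfl := eq_of_adj_support hG hgap (hg'.support p hp) hr (hcore y hy) hpr hpy
    exact hfar (((hnear r hy).trans hvr.symm).mono (by norm_num))
  have hcross : ∀ x ∈ P ∪ J, ∀ y ∈ P' ∪ J', ¬ G.Adj x y := by
    intro x hx y hy hxy
    rcases Finset.mem_union.1 hx with hx | hx <;> rcases Finset.mem_union.1 hy with hy | hy
    · exact hno x hx y hy hxy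
    · exact hPJ x hx y (Finset.mem_union_left _ hy) hxy
    · exact hPJ' y hy x (Finset.mem_union_left _ hx) hxy.symm
    · exact hnadj x (Finset.mem_union_left _ hx) y (Finset.mem_union_left _ hy) hxy
  have hmem : ∀ x, x ∈ (P ∪ P') ∪ (J ∪ J') ↔ x ∈ P ∪ J ∨ x ∈ P' ∪ J' := by
    intro x; simp only [Finset.mem_union]; tauto
  have hgad : IsGadget G (P ∪ P') (J ∪ J') (K ∪ K') := by
    refine ⟨?_, ?_, ?_, ?_, ?_, ?_⟩
    · exact fun p hp => (Finset.mem_union.1 hp).elim (hg.support p) (hg'.support p)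
    · exact fun p hp => (Finset.mem_union.1 hp).elim (hg.core_left p) (hg'.core_left p)
    · exact fun p hp => (Finset.mem_union.1 hp).elim (hg.core_right p) (hg'.core_right p)
    · intro x hx y hy hxy
      rcases (hmem x).1 hx with hx | hx <;> rcases (hmem y).1 hy with hy | hy
      · exact hg.indep_left x hx y hy hxy
      · exact hcross x hx y hy hxy
      · exact hcross y hy x hx hxy.symm
      · exact hg'.indep_left x hx y hy hxy
    · intro x hx y hy hxy
      rcases Finset.mem_union.1 hx with hx | hx <;> rcases Finset.mem_union.1 hy with hy | hy
      · exact hg.indep_right x hx y hy hxy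
      · exact hnadj x (Finset.mem_union_right _ hx) y (Finset.mem_union_right _ hy) hxy
      · exact hnadj y (Finset.mem_union_right _ hy) x (Finset.mem_union_right _ hx) hxy.symm
      · exact hg'.indep_right x hx y hy hxy
    · intro x hx y hy hxy
      rcases Finset.mem_union.1 hx with hx | hx
      · obtain ⟨b, hb, hby⟩ := hg.dom x hx y hy hxy
        exact ⟨b, (hmem b).2 (.inl hb), hby⟩
      · obtain ⟨b, hb, hby⟩ := hg'.dom x hx y hy hxy
        exact ⟨b, (hmem b).2 (.inr hb), hby⟩
  have hle := hgad.card_le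
  rw [Finset.card_union_of_disjoint (Finset.disjoint_left.2 fun x hx hx' =>
      hdisj x (Finset.mem_union_left _ hx) (Finset.mem_union_left _ hx')),
    Finset.card_union_of_disjoint (Finset.disjoint_left.2 fun x hx hx' =>
      hdisj x (Finset.mem_union_right _ hx) (Finset.mem_union_right _ hx'))] at hle
  omega

/-- There are at most 67 gadgets that are far from each other: among 68 of them, where any two use
adjacent support vertices, these would form a cycle of length four. -/
theorem card_le_of_pairwise_far (hG : HasNoShortCycles G) (hgap : independenceGap G ≤ 1)
    {F : Finset V} (hF : ∀ v ∈ F, IsCore G v)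
    (hfar : ∀ v ∈ F, ∀ v' ∈ F, v ≠ v' → ¬ CoreNear G 10 v v') : F.card ≤ 67 := by
  by_contra! hcard
  choose! P J K hL using fun v (hv : v ∈ F) => exists_isLocalGadget hG hgap (hF v hv)
  choose! col hcol using fun v (hv : v ∈ F) => exists_injOn_fin_two (hL v hv).2.2.1
  have hconf : ∀ v ∈ F, ∀ v' ∈ F, v ≠ v' → ∃ p q, p ∈ P v ∧ q ∈ P v' ∧ G.Adj p q := by
    intro v hv v' hv' hne
    obtain ⟨p, hp, q, hq, h⟩ := (hL v hv).exists_adj hG hgap (hL v' hv') (hfar v hv v' hv' hne)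
    exact ⟨p, q, hp, hq, h⟩
  choose! p q hp hq hpq using hconf
  -- Number the at most two support vertices of each gadget. For three fixed vertices there are
  -- `4 ^ 3 = 64` patterns of the numbers in the conflicts with another vertex. So two of the 65
  -- others, `w` and `w'`, have the same pattern, and for two of the three fixed vertices the number
  -- on the side of `w` is the same.
  obtain ⟨F₃, hF₃, hF₃c⟩ := Finset.exists_subset_card_eq (show 3 ≤ F.card by omega)
  let pat : V → F₃ → Fin 2 × Fin 2 := fun w i => (col i (p i w), col w (q i w))
  obtain ⟨w, hw, w', hw', hww', hpat⟩ :=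
    Finset.exists_ne_map_eq_of_card_lt_of_maps_to (s := F \ F₃) (t := Finset.univ) (f := pat)
      (by
        rw [Finset.card_univ, Finset.card_sdiff_of_subset hF₃]
        simp [hF₃c]
        omega) (fun _ _ => Finset.mem_coe.2 (Finset.mem_univ _))
  obtain ⟨i, i', hii', hcols⟩ : ∃ i i' : F₃, i ≠ i' ∧ (pat w i).2 = (pat w i').2 :=
    Fintype.exists_ne_map_eq_of_card_lt (fun i => (pat w i).2) (by simp [hF₃c])
  rw [Finset.mem_sdiff] at hw hw'
  have hne : ∀ (j : F₃) (x : V), x ∉ F₃ → (j : V) ≠ x := fun j x hx h => hx (h ▸ j.2)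
  have hF₃' : ∀ j : F₃, (j : V) ∈ F := fun j => hF₃ j.2
  have hq₁ : q i w = q i' w := hcol w hw.1 (hq i (hF₃' i) w hw.1 (hne i w hw.2))
    (hq i' (hF₃' i') w hw.1 (hne i' w hw.2)) hcols
  have hq₂ : q i w' = q i' w' := hcol w' hw'.1 (hq i (hF₃' i) w' hw'.1 (hne i w' hw'.2))
    (hq i' (hF₃' i') w' hw'.1 (hne i' w' hw'.2)) (by
      have h₁ := congrArg Prod.snd (congrFun hpat i)
      have h₂ := congrArg Prod.snd (congrFun hpat i')
      exact h₁.symm.trans (hcols.trans h₂))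
  have hp₁ : ∀ j : F₃, p j w = p j w' := fun j =>
    hcol j (hF₃' j) (hp j (hF₃' j) w hw.1 (hne j w hw.2))
      (hp j (hF₃' j) w' hw'.1 (hne j w' hw'.2)) (congrArg Prod.fst (congrFun hpat j))
  have hdisj : ∀ v ∈ F, ∀ v' ∈ F, v ≠ v' → ∀ x ∈ P v, x ∉ P v' := by
    intro v hv v' hv' hne x hx hx'
    obtain ⟨r, hr, hxr, hvr⟩ := (hL v hv).2.2.2.2 x hx
    obtain ⟨r', hr', hxr', hvr'⟩ := (hL v' hv').2.2.2.2 x hx'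
    obtain rfl := eq_of_adj_support hG hgap ((hL v hv).1.support x hx) hr hr' hxr hxr'
    exact hfar v hv v' hv' hne ((hvr.trans hvr'.symm).mono (by norm_num))
  have a₁ := hpq i (hF₃' i) w hw.1 (hne i w hw.2)
  have a₂ := hpq i' (hF₃' i') w hw.1 (hne i' w hw.2)
  have a₃ := hpq i' (hF₃' i') w' hw'.1 (hne i' w' hw'.2)
  have a₄ := hpq i (hF₃' i) w' hw'.1 (hne i w' hw'.2)
  rw [← hq₁] at a₂
  rw [← hq₂, ← hp₁ i'] at a₃
  rw [← hp₁ i] at a₄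
  rcases hG.no4 _ _ _ _ a₁ a₂.symm a₃ a₄.symm with h | h
  · exact hdisj i (hF₃' i) i' (hF₃' i') (fun h => hii' (Subtype.ext h)) _
      (hp i (hF₃' i) w hw.1 (hne i w hw.2)) (h ▸ hp i' (hF₃' i') w hw.1 (hne i' w hw.2))
  · exact hdisj w hw.1 w' hw'.1 hww' _ (hq i (hF₃' i) w hw.1 (hne i w hw.2))
      (h ▸ hq i (hF₃' i) w' hw'.1 (hne i w' hw'.2))

/-- The core of a graph of independence gap at most one is bounded. -/
theorem card_core_le (hG : HasNoShortCycles G) (hgap : independenceGap G ≤ 1) :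
    (core G).card ≤ 67 * 3 ^ 10 := by
  classical
  obtain ⟨F, hF, hmax⟩ := Finset.exists_max_image
    ((core G).powerset.filter fun F => ∀ v ∈ F, ∀ v' ∈ F, v ≠ v' → ¬ CoreNear G 10 v v')
    Finset.card ⟨∅, by simp⟩
  rw [Finset.mem_filter, Finset.mem_powerset] at hF
  choose s hs hs' using exists_finset_coreNear hG hgap 10
  have hcov : core G ⊆ F.biUnion s := by
    intro v hv
    by_contra hvF
    have hfar : ∀ u ∈ F, ¬ CoreNear G 10 u v := fun u hu h =>
      hvF (Finset.mem_biUnion.2 ⟨u, hu, hs' u v h⟩)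
    have hvF' : v ∉ F := fun h => hfar v h ((CoreNear.refl v).mono (by norm_num))
    have := hmax (insert v F) (Finset.mem_filter.2 ⟨Finset.mem_powerset.2
      (Finset.insert_subset hv hF.1), ?_⟩)
    · rw [Finset.card_insert_of_notMem hvF'] at this
      omega
    · intro x hx y hy hxy
      rcases Finset.mem_insert.1 hx with hx' | hx' <;> rcases Finset.mem_insert.1 hy with hy' | hy'
      · exact absurd (hx'.trans hy'.symm) hxy
      · exact fun h => hfar y hy' (hx' ▸ h.symm)
      · exact hy' ▸ hfar x hx'
      · exact hF.2 x hx' y hy' hxy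
  refine (Finset.card_le_card hcov).trans ((Finset.card_biUnion_le_card_mul _ _ _ fun v _ =>
    hs v).trans (Nat.mul_le_mul_right _ ?_))
  exact card_le_of_pairwise_far hG hgap (fun v hv => mem_core.1 (hF.1 hv)) hF.2

end CoreBound

/-! ### Bounded witnesses for the independence gap -/

section Witness

variable {V : Type*} (G : SimpleGraph V)

/-- A witness of size `b` for an independence gap of at least `k`: independent sets of at most `b`
and of exactly `b + k` vertices, as tuples, the first of which can be exchanged for the second in a
maximal independent set. -/
def HasWitness (k b : ℕ) : Prop :=
  ∃ f : Fin b → V, ∃ g : Fin (b + k) → V, (∀ i j, i ≠ j → g i ≠ g j) ∧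
    (∀ i j, ¬ G.Adj (f i) (f j)) ∧ (∀ i j, ¬ G.Adj (g i) (g j)) ∧
    (∀ i, IsBranching G (f i)) ∧ (∀ i, ¬ HasLeaf G (g i)) ∧
    (∀ i, ∃ j, f j = g i ∨ G.Adj (f j) (g i)) ∧
    ∀ r, IsCore G r → ∃ j, f j = r ∨ G.Adj (f j) r

variable {G} [Fintype V] [DecidableEq V]

theorem HasWitness.le_independenceGap {k b : ℕ} (h : HasWitness G k b) :
    k ≤ independenceGap G := by
  obtain ⟨f, g, hinj, hf, hg, hfb, hgl, hgd, hdom⟩ := h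
  have hinj' : Function.Injective g := fun i j hij => by_contra fun hne => hinj i j hne hij
  have hA : (Finset.univ.image g).card = b + k := by
    rw [Finset.card_image_of_injective _ hinj']; simp
  have hB : (Finset.univ.image f).card ≤ b := Finset.card_image_le.trans (by simp)
  have := card_le_card_add_independenceGap (G := G) (A := Finset.univ.image g)
    (B := Finset.univ.image f) (by simpa using hg) (by simpa using hf) (by simpa using hfb)
    (by simpa using hgl) (by
      simp only [Finset.mem_image, Finset.mem_univ, true_and, forall_exists_index,
        forall_apply_eq_imp_iff, exists_exists_eq_and]
      intro i y hy
      by_cases hyl : HasLeaf G y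
      · exact .inr hyl
      rcases hy with rfl | hy
      · exact .inl (hgd i)
      · refine .inl (hdom y ⟨by_contra fun hyb => ?_, hyl⟩)
        exact hgl i ⟨y, hy, isLeaf_of_adj_of_not_isBranching hy.symm hyb⟩)
  omega

/-- A large independence gap shows up between sets consisting of core vertices and leaves on one
side, and of all vertices of degree at least two of a maximal independent set on the other. -/
theorem exists_exchange_of_le_independenceGap {k : ℕ} (hk : k ≤ independenceGap G) :
    ∃ A B : Finset V, B.card + k ≤ A.card ∧ (∀ x ∈ A, ∀ y ∈ A, ¬ G.Adj x y) ∧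
      (∀ x ∈ B, ∀ y ∈ B, ¬ G.Adj x y) ∧ (∀ b ∈ B, IsBranching G b) ∧
      (∀ a ∈ A, ¬ HasLeaf G a) ∧ (∀ a ∈ A, IsCore G a ∨ IsLeaf G a ∧ ∃ b ∈ B, G.Adj b a) ∧
      (∀ l, IsLeaf G l → ∀ b ∈ B, G.Adj b l → l ∈ A) ∧
      ∀ r, IsCore G r → ∃ b ∈ B, b = r ∨ G.Adj b r := by
  classical
  obtain ⟨I, hI, hIc⟩ := exists_card_eq_minMaximalIndepNum G
  obtain ⟨M, hM⟩ := G.exists_isNIndepSet_indepNum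
  have hIind := isIndepSet_iff_forall_not_adj.1 hI.prop
  have hMind := isIndepSet_iff_forall_not_adj.1 hM.isIndepSet
  have hIdom : ∀ v, v ∉ I → ∃ u ∈ I, G.Adj u v := by
    intro v hv
    by_contra! h
    refine hv (hI.le_of_ge (y := insert v I) ?_ (Finset.subset_insert v I)
      (Finset.mem_insert_self v I))
    rw [isIndepSet_iff_forall_not_adj]
    intro x hx y hy hxy
    rcases Finset.mem_insert.1 hx with hx' | hx' <;> rcases Finset.mem_insert.1 hy with hy' | hy'
    · exact hxy.ne (hx'.trans hy'.symm)
    · exact h y hy' (hx' ▸ hxy.symm)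
    · exact h x hx' (hy' ▸ hxy)
    · exact hIind x hx' y hy' hxy
  let B := I.filter (IsBranching G)
  let L : Finset V := Finset.univ.filter fun l => IsLeaf G l ∧ ∃ b ∈ B, G.Adj b l
  have hBspec : ∀ {b}, b ∈ B ↔ b ∈ I ∧ IsBranching G b := Finset.mem_filter
  have hLspec : ∀ {l}, l ∈ L ↔ IsLeaf G l ∧ ∃ b ∈ B, G.Adj b l := by simp [L]
  have hLadj : ∀ l ∈ L, ∀ y, G.Adj l y → y ∈ B := by
    intro l hl y hly
    obtain ⟨⟨u, -, hu⟩, b, hb, hbl⟩ := hLspec.1 hl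
    rw [hu y hly, ← hu b hbl.symm]
    exact hb
  have hLI : Disjoint L (I \ B) := Finset.disjoint_left.2 fun l hl hl' => by
    obtain ⟨-, b, hb, hbl⟩ := hLspec.1 hl
    exact hIind b (hBspec.1 hb).1 l (Finset.mem_sdiff.1 hl').1 hbl
  have hmap : ∀ m ∈ M.filter fun m => ¬ IsCore G m, ∃ y ∈ L ∪ I \ B,
      ¬ IsBranching G y ∧ (y = m ∨ G.Adj m y) := by
    intro m hm
    obtain ⟨hmM, hmc⟩ := Finset.mem_filter.1 hm
    have hleaf : ∀ l, IsLeaf G l → (∀ b, G.Adj l b → IsBranching G b) → l ∈ L ∪ I \ B := by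
      intro l hl hlb
      by_cases hlI : l ∈ I
      · exact Finset.mem_union_right _ (Finset.mem_sdiff.2
          ⟨hlI, fun h => (hBspec.1 h).2.not_isLeaf hl⟩)
      · obtain ⟨u, hu, hul⟩ := hIdom l hlI
        exact Finset.mem_union_left _ (hLspec.2 ⟨hl, u, hBspec.2 ⟨hu, hlb u hul.symm⟩, hul⟩)
    by_cases hmb : IsBranching G m
    · obtain ⟨l, hml, hl⟩ : HasLeaf G m := by_contra fun h => hmc ⟨hmb, h⟩
      refine ⟨l, hleaf l hl fun b hb => ?_, fun h => h.not_isLeaf hl, .inr hml⟩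
      obtain ⟨u, -, hu⟩ := hl
      rwa [hu b hb, ← hu m hml.symm]
    · by_cases hmI : m ∈ I
      · exact ⟨m, Finset.mem_union_right _ (Finset.mem_sdiff.2
          ⟨hmI, fun h => hmb (hBspec.1 h).2⟩), hmb, .inl rfl⟩
      · obtain ⟨u, hu, hum⟩ := hIdom m hmI
        have hml := isLeaf_of_adj_of_not_isBranching hum.symm hmb
        by_cases hub : IsBranching G u
        · exact ⟨m, Finset.mem_union_left _ (hLspec.2 ⟨hml, u, hBspec.2 ⟨hu, hub⟩, hum⟩), hmb,
            .inl rfl⟩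
        · exact ⟨u, Finset.mem_union_right _ (Finset.mem_sdiff.2
            ⟨hu, fun h => hub (hBspec.1 h).2⟩), hub, .inr hum.symm⟩
  choose! φ hφ using hmap
  have hcard : (M.filter fun m => ¬ IsCore G m).card ≤ (L ∪ I \ B).card := by
    refine Finset.card_le_card_of_injOn φ (fun m hm => (hφ m hm).1) ?_
    intro m hm m' hm' heq
    obtain ⟨-, hb, h⟩ := hφ m hm
    obtain ⟨-, -, h'⟩ := hφ m' hm'
    rw [← heq] at h'
    have hMm := (Finset.mem_filter.1 hm).1
    have hMm' := (Finset.mem_filter.1 hm').1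
    rcases h with h | h <;> rcases h' with h' | h'
    · exact h.symm.trans h'
    · exact absurd (h ▸ h') (hMind m' hMm' m hMm)
    · exact absurd (h' ▸ h) (hMind m hMm m' hMm')
    · exact by_contra fun hne => hb ⟨m, m', hne, h.symm, h'.symm⟩
  have hAL : Disjoint (M.filter (IsCore G)) L := Finset.disjoint_left.2 fun x hx hx' =>
    (Finset.mem_filter.1 hx).2.1.not_isLeaf (hLspec.1 hx').1
  have hcoreL : ∀ x ∈ M.filter (IsCore G), ∀ l ∈ L, ¬ G.Adj x l := fun x hx l hl h =>
    (Finset.mem_filter.1 hx).2.2 ⟨l, h, (hLspec.1 hl).1⟩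
  refine ⟨M.filter (IsCore G) ∪ L, B, ?_, ?_, ?_, ?_, ?_, ?_, ?_, ?_⟩
  · have h₁ := Finset.card_filter_add_card_filter_not (s := M) (IsCore G)
    rw [Finset.card_union_of_disjoint hLI, Finset.card_sdiff_of_subset
      (Finset.filter_subset _ _)] at hcard
    have h₂ := Finset.card_le_card (Finset.filter_subset (IsBranching G) I)
    rw [Finset.card_union_of_disjoint hAL]
    have h₃ := hM.card_eq
    unfold independenceGap at hk
    change _ ≤ L.card + (I.card - (I.filter (IsBranching G)).card) at hcard
    change (I.filter (IsBranching G)).card + k ≤ _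
    have := minMaximalIndepNum_le_indepNum G
    omega
  · intro x hx y hy hxy
    rcases Finset.mem_union.1 hx with hx | hx
    · rcases Finset.mem_union.1 hy with hy | hy
      · exact hMind x (Finset.mem_filter.1 hx).1 y (Finset.mem_filter.1 hy).1 hxy
      · exact hcoreL x hx y hy hxy
    · rcases Finset.mem_union.1 hy with hy | hy
      · exact hcoreL y hy x hx hxy.symm
      · exact (hBspec.1 (hLadj x hx y hxy)).2.not_isLeaf (hLspec.1 hy).1
  · exact fun x hx y hy => hIind x (hBspec.1 hx).1 y (hBspec.1 hy).1
  · exact fun b hb => (hBspec.1 hb).2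
  · intro a ha
    rcases Finset.mem_union.1 ha with ha | ha
    · exact (Finset.mem_filter.1 ha).2.2
    · rintro ⟨l, hal, hl⟩
      exact (hBspec.1 (hLadj a ha l hal)).2.not_isLeaf hl
  · intro a ha
    rcases Finset.mem_union.1 ha with ha | ha
    · exact .inl (Finset.mem_filter.1 ha).2
    · exact .inr (hLspec.1 ha)
  · exact fun l hl b hb hbl => Finset.mem_union_right _ (hLspec.2 ⟨hl, b, hb, hbl⟩)
  · intro r hr
    by_cases hrI : r ∈ I
    · exact ⟨r, hBspec.2 ⟨hrI, hr.1⟩, .inl rfl⟩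
    · obtain ⟨u, hu, hur⟩ := hIdom r hrI
      exact ⟨u, hBspec.2 ⟨hu, hr.isBranching_of_adj hur.symm⟩, .inr hur⟩

/-- If the core is bounded, then the exchange can be restricted to a bounded number of
vertices: one dominating each core vertex, and further ones with at least two leaves. -/
theorem exists_hasWitness {k C : ℕ} (hk : k ≤ independenceGap G) (hC : (core G).card ≤ C) :
    ∃ b ≤ 2 * C + k, HasWitness G k b := by
  classical
  obtain ⟨A, B, hAB, hA, hB, hBb, hAl, hAt, hAL, hdom⟩ := exists_exchange_of_le_independenceGap hk
  choose! dom hdomB hdomr using hdom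
  let B₁ : Finset V := (core G).image dom
  have hB₁B : B₁ ⊆ B := fun b hb => by
    obtain ⟨r, hr, rfl⟩ := Finset.mem_image.1 hb
    exact hdomB r (mem_core.1 hr)
  have hB₁c : B₁.card ≤ C := Finset.card_image_le.trans hC
  have hB₁dom : ∀ r, IsCore G r → ∃ b ∈ B₁, b = r ∨ G.Adj b r := fun r hr =>
    ⟨dom r, Finset.mem_image_of_mem _ (mem_core.2 hr), hdomr r hr⟩
  suffices ∃ B' ⊆ B, B₁ ⊆ B' ∧ B'.card ≤ 2 * C + k ∧
      B'.card + k ≤ (A.filter fun a => ∃ b ∈ B', b = a ∨ G.Adj b a).card by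
    obtain ⟨B', hB'B, hB₁B', hB'c, hA'⟩ := this
    obtain ⟨A', hA'A, hA'c⟩ := Finset.exists_subset_card_eq hA'
    have hA's : ∀ a ∈ A', a ∈ A ∧ ∃ b ∈ B', b = a ∨ G.Adj b a := fun a ha =>
      Finset.mem_filter.1 (hA'A ha)
    let f : Fin B'.card → V := fun i => B'.equivFin.symm i
    have hf : ∀ i, f i ∈ B' := fun i => (B'.equivFin.symm i).2
    have hf' : ∀ b ∈ B', ∃ i, f i = b := fun b hb => ⟨B'.equivFin ⟨b, hb⟩, by simp [f]⟩
    let g : Fin (B'.card + k) → V := fun i => (A'.equivFinOfCardEq hA'c).symm i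
    have hg : ∀ i, g i ∈ A' := fun i => ((A'.equivFinOfCardEq hA'c).symm i).2
    refine ⟨B'.card, hB'c, f, g, ?_, ?_, ?_, ?_, ?_, ?_, ?_⟩
    · exact fun i j hij h => hij ((A'.equivFinOfCardEq hA'c).symm.injective (Subtype.ext h))
    · exact fun i j => hB _ (hB'B (hf i)) _ (hB'B (hf j))
    · exact fun i j => hA _ (hA's _ (hg i)).1 _ (hA's _ (hg j)).1
    · exact fun i => hBb _ (hB'B (hf i))
    · exact fun i => hAl _ (hA's _ (hg i)).1
    · intro i
      obtain ⟨b, hb, h⟩ := (hA's _ (hg i)).2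
      obtain ⟨j, rfl⟩ := hf' b hb
      exact ⟨j, h⟩
    · intro r hr
      obtain ⟨b, hb, h⟩ := hB₁dom r hr
      obtain ⟨j, rfl⟩ := hf' b (hB₁B' hb)
      exact ⟨j, h⟩
  have huniq : ∀ l b b', IsLeaf G l → G.Adj b l → G.Adj b' l → b = b' := by
    rintro l b b' ⟨u, -, hu⟩ hb hb'
    rw [hu b hb.symm, hu b' hb'.symm]
  let Q : Finset V := (B \ B₁).filter fun b =>
    ∃ l l', l ≠ l' ∧ IsLeaf G l ∧ IsLeaf G l' ∧ G.Adj b l ∧ G.Adj b l'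
  have hQB : Q ⊆ B := (Finset.filter_subset _ _).trans Finset.sdiff_subset
  have hQdisj : ∀ Q' ⊆ Q, (B₁ ∪ Q').card = B₁.card + Q'.card := fun Q' hQ' =>
    Finset.card_union_of_disjoint (Finset.disjoint_left.2 fun x hx hx' =>
      (Finset.mem_sdiff.1 (Finset.mem_filter.1 (hQ' hx')).1).2 hx)
  rcases le_total (C + k) Q.card with hQ | hQ
  · -- Many vertices have two leaves: they alone account for the gap.
    obtain ⟨Q', hQ'Q, hQ'c⟩ := Finset.exists_subset_card_eq hQ
    have hc := hQdisj Q' hQ'Q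
    refine ⟨B₁ ∪ Q', Finset.union_subset hB₁B (hQ'Q.trans hQB), Finset.subset_union_left,
      by omega, ?_⟩
    choose! l l' hll' hl hl' hbl hbl' using fun b (hb : b ∈ Q') =>
      (Finset.mem_filter.1 (hQ'Q hb)).2
    have hsub : Q'.image l ∪ Q'.image l' ⊆
        A.filter fun a => ∃ b ∈ B₁ ∪ Q', b = a ∨ G.Adj b a := by
      intro a ha
      rw [Finset.mem_filter]
      rcases Finset.mem_union.1 ha with ha | ha <;> obtain ⟨b, hb, rfl⟩ := Finset.mem_image.1 ha
      · exact ⟨hAL _ (hl b hb) b (hQB (hQ'Q hb)) (hbl b hb), b, Finset.mem_union_right _ hb,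
          .inr (hbl b hb)⟩
      · exact ⟨hAL _ (hl' b hb) b (hQB (hQ'Q hb)) (hbl' b hb), b, Finset.mem_union_right _ hb,
          .inr (hbl' b hb)⟩
    have hcard := Finset.card_le_card hsub
    rw [Finset.card_union_of_disjoint, Finset.card_image_of_injOn, Finset.card_image_of_injOn]
      at hcard
    · omega
    · exact fun b hb b' hb' h => huniq (l' b) b b' (hl' b hb) (hbl' b hb) (h ▸ hbl' b' hb')
    · exact fun b hb b' hb' h => huniq (l b) b b' (hl b hb) (hbl b hb) (h ▸ hbl b' hb')
    · refine Finset.disjoint_left.2 fun a ha ha' => ?_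
      obtain ⟨b, hb, rfl⟩ := Finset.mem_image.1 ha
      obtain ⟨b', hb', h⟩ := Finset.mem_image.1 ha'
      obtain rfl := huniq (l b) b b' (hl b hb) (hbl b hb) (h ▸ hbl' b' hb')
      exact hll' b hb h.symm
  · -- Few vertices have two leaves: the others can be left out together with their leaves.
    have hc := hQdisj Q subset_rfl
    refine ⟨B₁ ∪ Q, Finset.union_subset hB₁B hQB, Finset.subset_union_left, by omega, ?_⟩
    have hBsub : B₁ ∪ Q ⊆ B := Finset.union_subset hB₁B hQB
    have hrest : ∀ a ∈ A.filter fun a => ¬ ∃ b ∈ B₁ ∪ Q, b = a ∨ G.Adj b a,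
        ∃ b ∈ B \ (B₁ ∪ Q), IsLeaf G a ∧ G.Adj b a := by
      intro a ha
      obtain ⟨haA, han⟩ := Finset.mem_filter.1 ha
      rcases hAt a haA with hac | ⟨hal, b, hb, hba⟩
      · obtain ⟨b, hb, h⟩ := hB₁dom a hac
        exact absurd ⟨b, Finset.mem_union_left _ hb, h⟩ han
      · exact ⟨b, Finset.mem_sdiff.2 ⟨hb, fun h => han ⟨b, h, .inr hba⟩⟩, hal, hba⟩
    choose! s hs hsl hsa using hrest
    have hcard := Finset.card_le_card_of_injOn s hs (fun a ha a' ha' h => by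
      by_contra hne
      obtain ⟨hsB, hsn⟩ := Finset.mem_sdiff.1 (hs a ha)
      refine hsn (Finset.mem_union_right _ (Finset.mem_filter.2 ⟨Finset.mem_sdiff.2
        ⟨hsB, fun h' => hsn (Finset.mem_union_left _ h')⟩,
        a, a', hne, hsl a ha, hsl a' ha', hsa a ha, ?_⟩))
      rw [h]
      exact hsa a' ha')
    rw [Finset.card_sdiff_of_subset hBsub] at hcard
    have h₁ := Finset.card_filter_add_card_filter_not (s := A)
      (fun a => ∃ b ∈ B₁ ∪ Q, b = a ∨ G.Adj b a)
    have h₂ := Finset.card_le_card hBsub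
    omega

/-- On graphs without short cycles, being almost well-covered is a matter of boundedly many
vertices at a time. -/
theorem almostWellCovered_iff (hG : HasNoShortCycles G) {C : ℕ} (hC : C = 67 * 3 ^ 10) :
    AlmostWellCovered G ↔
      (¬ ∃ h : Fin (C + 1) → V, (∀ i j, i ≠ j → h i ≠ h j) ∧ ∀ i, IsCore G (h i)) ∧
      (∃ b : Fin (2 * C + 2), HasWitness G 1 b) ∧ ¬ ∃ b : Fin (2 * C + 3), HasWitness G 2 b := by
  have hcore : (core G).card ≤ C ↔
      ¬ ∃ h : Fin (C + 1) → V, (∀ i j, i ≠ j → h i ≠ h j) ∧ ∀ i, IsCore G (h i) := by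
    rw [← not_lt, not_iff_not]
    constructor
    · intro h
      obtain ⟨s, hs, hsc⟩ := Finset.exists_subset_card_eq (Nat.succ_le_of_lt h)
      refine ⟨fun i => (s.equivFinOfCardEq hsc).symm i, fun i j hij h' => hij
        ((s.equivFinOfCardEq hsc).symm.injective (Subtype.ext h')), fun i =>
        mem_core.1 (hs ((s.equivFinOfCardEq hsc).symm i).2)⟩
    · rintro ⟨h, hinj, hh⟩
      have hinj' : Function.Injective h := fun i j hij => by_contra fun hne => hinj i j hne hij
      have := Finset.card_le_card (show Finset.univ.image h ⊆ core G from fun x hx => by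
        obtain ⟨i, -, rfl⟩ := Finset.mem_image.1 hx
        exact mem_core.2 (hh i))
      rw [Finset.card_image_of_injective _ hinj', Finset.card_univ, Fintype.card_fin] at this
      omega
  rw [← hcore]
  unfold AlmostWellCovered
  constructor
  · intro h
    have hc : (core G).card ≤ C := hC ▸ card_core_le hG h.le
    obtain ⟨b, hb, hw⟩ := exists_hasWitness h.ge hc
    refine ⟨hc, ⟨⟨b, by omega⟩, hw⟩, ?_⟩
    rintro ⟨b, hb⟩
    have := hb.le_independenceGap
    omega
  · rintro ⟨hc, ⟨b, hb⟩, h2⟩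
    have h1 := hb.le_independenceGap
    by_contra hne
    obtain ⟨b, hb, hw⟩ := exists_hasWitness (k := 2) (G := G) (by omega) hc
    exact h2 ⟨⟨b, by omega⟩, hw⟩

end Witness

/-! ### First-order definability -/

open FirstOrder Language

/-- A property of the values of variables in a finite graph is defined by a first-order formula,
the same for all graphs. -/
def FODefinable {α : Type} (P : ∀ n, SimpleGraph (Fin n) → (α → Fin n) → Prop) : Prop :=
  ∃ φ : Language.graph.Formula α, ∀ n (G : SimpleGraph (Fin n)) (x : α → Fin n),
    letI := G.structure
    φ.Realize x ↔ P n G x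

namespace FODefinable

variable {α β ι : Type} {P Q : ∀ n, SimpleGraph (Fin n) → (α → Fin n) → Prop}

theorem adj (a b : α) : FODefinable fun _ G (x : α → _) => G.Adj (x a) (x b) :=
  ⟨Relations.formula₂ Language.adj (.var a) (.var b), fun n G x => by
    let := G.structure
    rw [Formula.realize_rel₂]
    rfl⟩

theorem eq (a b : α) : FODefinable fun _ _ (x : α → _) => x a = x b :=
  ⟨Term.equal (.var a) (.var b), fun n G x => by
    let := G.structure
    rw [Formula.realize_equal]
    rfl⟩

theorem not (h : FODefinable P) : FODefinable fun n G x => ¬ P n G x :=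
  let ⟨φ, hφ⟩ := h
  ⟨φ.not, fun n G x => by
    let := G.structure
    rw [Formula.realize_not, hφ]⟩

theorem and (h : FODefinable P) (h' : FODefinable Q) :
    FODefinable fun n G x => P n G x ∧ Q n G x :=
  let ⟨φ, hφ⟩ := h
  let ⟨ψ, hψ⟩ := h'
  ⟨φ ⊓ ψ, fun n G x => by
    let := G.structure
    rw [Formula.realize_inf, hφ, hψ]⟩

theorem or (h : FODefinable P) (h' : FODefinable Q) :
    FODefinable fun n G x => P n G x ∨ Q n G x :=
  let ⟨φ, hφ⟩ := h
  let ⟨ψ, hψ⟩ := h'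
  ⟨φ ⊔ ψ, fun n G x => by
    let := G.structure
    rw [Formula.realize_sup, hφ, hψ]⟩

theorem imp (h : FODefinable P) (h' : FODefinable Q) :
    FODefinable fun n G x => P n G x → Q n G x :=
  let ⟨φ, hφ⟩ := h
  let ⟨ψ, hψ⟩ := h'
  ⟨φ.imp ψ, fun n G x => by
    let := G.structure
    rw [Formula.realize_imp, hφ, hψ]⟩

/-- A property that does not depend on the graph is definable. -/
theorem const (p : Prop) : FODefinable fun _ _ (_ : α → _) => p := by
  by_cases hp : p
  · exact ⟨⊤, fun n G x => by simp [hp]⟩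
  · exact ⟨⊥, fun n G x => by simp [hp]⟩

theorem finite_forall [Finite ι] {P : ι → ∀ n, SimpleGraph (Fin n) → (α → Fin n) → Prop}
    (h : ∀ i, FODefinable (P i)) : FODefinable fun n G x => ∀ i, P i n G x := by
  choose φ hφ using h
  refine ⟨Formula.iInf φ, fun n G x => ?_⟩
  let := G.structure
  rw [Formula.realize_iInf]
  exact forall_congr' fun i => hφ i n G x

theorem finite_exists [Finite ι] {P : ι → ∀ n, SimpleGraph (Fin n) → (α → Fin n) → Prop}
    (h : ∀ i, FODefinable (P i)) : FODefinable fun n G x => ∃ i, P i n G x := by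
  choose φ hφ using h
  refine ⟨Formula.iSup φ, fun n G x => ?_⟩
  let := G.structure
  rw [Formula.realize_iSup]
  exact exists_congr fun i => hφ i n G x

theorem exists_tuple [Finite β]
    {P : ∀ n, SimpleGraph (Fin n) → (α → Fin n) → (β → Fin n) → Prop}
    (h : FODefinable fun n G (x : α ⊕ β → Fin n) => P n G (x ∘ .inl) (x ∘ .inr)) :
    FODefinable fun n G x => ∃ y, P n G x y := by
  obtain ⟨φ, hφ⟩ := h
  refine ⟨φ.iExs β, fun n G x => ?_⟩
  let := G.structure
  rw [Formula.realize_iExs]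
  exact exists_congr fun y => hφ n G (Sum.elim x y)

theorem exists_vertex {P : ∀ n, SimpleGraph (Fin n) → (α → Fin n) → Fin n → Prop}
    (h : FODefinable fun n G (x : α ⊕ Unit → Fin n) => P n G (x ∘ .inl) (x (.inr ()))) :
    FODefinable fun n G x => ∃ y, P n G x y := by
  obtain ⟨φ, hφ⟩ := exists_tuple (P := fun n G x y => P n G x (y ())) h
  refine ⟨φ, fun n G x => (hφ n G x).trans ⟨fun ⟨y, hy⟩ => ⟨y (), hy⟩, fun ⟨y, hy⟩ =>
    ⟨fun _ => y, hy⟩⟩⟩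

theorem forall_vertex {P : ∀ n, SimpleGraph (Fin n) → (α → Fin n) → Fin n → Prop}
    (h : FODefinable fun n G (x : α ⊕ Unit → Fin n) => P n G (x ∘ .inl) (x (.inr ()))) :
    FODefinable fun n G x => ∀ y, P n G x y := by
  obtain ⟨φ, hφ⟩ := (exists_vertex (P := fun n G x y => ¬ P n G x y) h.not).not
  exact ⟨φ, fun n G x => (hφ n G x).trans not_exists_not⟩

theorem isLeaf (a : α) : FODefinable fun _ G (x : α → _) => IsLeaf G (x a) := by
  refine exists_vertex (P := fun _ G x u => G.Adj (x a) u ∧ ∀ w, G.Adj (x a) w → w = u) ?_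
  refine and (adj (Sum.inl a) (Sum.inr ())) ?_
  refine forall_vertex (P := fun _ G x w => G.Adj (x (Sum.inl a)) w → w = x (Sum.inr ())) ?_
  exact imp (adj (Sum.inl (Sum.inl a)) (Sum.inr ())) (eq (Sum.inr ()) (Sum.inl (Sum.inr ())))

theorem hasLeaf (a : α) : FODefinable fun _ G (x : α → _) => HasLeaf G (x a) := by
  refine exists_vertex (P := fun _ G x l => G.Adj (x a) l ∧ IsLeaf G l) ?_
  exact and (adj (Sum.inl a) (Sum.inr ())) (isLeaf (Sum.inr ()))

theorem isBranching (a : α) : FODefinable fun _ G (x : α → _) => IsBranching G (x a) := by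
  refine exists_vertex
    (P := fun _ G x u => ∃ w, u ≠ w ∧ G.Adj (x a) u ∧ G.Adj (x a) w) ?_
  refine exists_vertex (P := fun _ G x w =>
    x (Sum.inr ()) ≠ w ∧ G.Adj (x (Sum.inl a)) (x (Sum.inr ())) ∧ G.Adj (x (Sum.inl a)) w) ?_
  exact and (not (eq (Sum.inl (Sum.inr ())) (Sum.inr ())))
    (and (adj (Sum.inl (Sum.inl a)) (Sum.inl (Sum.inr ())))
      (adj (Sum.inl (Sum.inl a)) (Sum.inr ())))

theorem isCore (a : α) : FODefinable fun _ G (x : α → _) => IsCore G (x a) :=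
  and (isBranching a) (not (hasLeaf a))

theorem hasWitness (k b : ℕ) :
    FODefinable fun _ G (_ : Empty → _) => HasWitness G k b := by
  refine exists_tuple (β := Fin b) (P := fun n G _ f => ∃ g : Fin (b + k) → Fin n, _) ?_
  refine exists_tuple (β := Fin (b + k)) (P := fun n G x g => _ ∧ _) ?_
  let f (i : Fin b) : (Empty ⊕ Fin b) ⊕ Fin (b + k) := .inl (.inr i)
  let g (i : Fin (b + k)) : (Empty ⊕ Fin b) ⊕ Fin (b + k) := .inr i
  refine and (finite_forall fun i => finite_forall fun j =>
    imp (const (i ≠ j)) (not (eq (g i) (g j)))) ?_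
  refine and (finite_forall fun i => finite_forall fun j => not (adj (f i) (f j))) ?_
  refine and (finite_forall fun i => finite_forall fun j => not (adj (g i) (g j))) ?_
  refine and (finite_forall fun i => isBranching (f i)) ?_
  refine and (finite_forall fun i => not (hasLeaf (g i))) ?_
  refine and (finite_forall fun i => finite_exists fun j =>
    or (eq (f j) (g i)) (adj (f j) (g i))) ?_
  refine forall_vertex
    (P := fun _ G x r => IsCore G r → ∃ j, x (f j) = r ∨ G.Adj (x (f j)) r) ?_
  exact imp (isCore (Sum.inr ())) <| finite_exists fun j =>
    or (eq (Sum.inl (f j)) (Sum.inr ())) (adj (Sum.inl (f j)) (Sum.inr ()))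

/-- The right-hand side of `almostWellCovered_iff` is a first-order property. -/
theorem boundedCore_and_hasWitness (C : ℕ) :
    FODefinable fun n G (_ : Empty → Fin n) =>
      (¬ ∃ h : Fin (C + 1) → Fin n, (∀ i j, i ≠ j → h i ≠ h j) ∧ ∀ i, IsCore G (h i)) ∧
      (∃ b : Fin (2 * C + 2), HasWitness G 1 b) ∧ ¬ ∃ b : Fin (2 * C + 3), HasWitness G 2 b := by
  refine and (not ?_) (and (finite_exists fun b => hasWitness 1 b)
    (not (finite_exists fun b => hasWitness 2 b)))
  refine exists_tuple (P := fun _ G _ h => (∀ i j, i ≠ j → h i ≠ h j) ∧ ∀ i, IsCore G (h i)) ?_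
  exact and (finite_forall fun i => finite_forall fun j =>
    imp (const (i ≠ j)) (not (eq (Sum.inr i) (Sum.inr j)))) (finite_forall fun i =>
      isCore (Sum.inr i))

end FODefinable

theorem mainTheorem3 :
    DecidableInPolyTimeOn (fun G => IsC3C4C5C7Free G.2) (fun G => AlmostWellCovered G.2) := by
  -- The bound is hidden behind a variable, so that it is never evaluated.
  obtain ⟨C, hC⟩ : ∃ C, C = 67 * 3 ^ 10 := ⟨_, rfl⟩
  obtain ⟨φ, hφ⟩ := FODefinable.boundedCore_and_hasWitness C
  exact decidableInPolyTimeOn_of_sentence φ fun G hG =>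
    (almostWellCovered_iff hG.hasNoShortCycles hC).trans (hφ G.1 G.2 default).symm
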